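/- Conventions. Write $X\otimes Y: r\to t$ for the composite of 1-morphisms $X: r\to s$ and $Y: s\to t$. A \emph{dagger 2-category} is a 2-category (not necessarily strict) in which every Hom-category carries a contravariant identity-on-objects involutive functor $f\mapsto f^\dagger$, with $(f\otimes g)^\dagger=f^\dagger\otimes g^\dagger$ and unitary coherence isomorphisms; a 2-morphism $f: X\to Y$ is an \emph{isometry} if $f^\dagger f=\mathrm{id}_X$, and \emph{unitary} if moreover $ff^\dagger=\mathrm{id}_Y$. It is \emph{pivotal dagger} if every 1-morphism $X: r\to s$ has a chosen right dual $X^*: s\to r$ with cup $\eta_X:\mathrm{id}_s\to X^*\otimes X$ and cap $\epsilon_X: X\otimes X^*\to\mathrm{id}_r$ satisfying the snake equations, together with an invertible icon $\iota_X: X^{**}\to X$ from the double duals pseudofunctor to the identity, such that the resulting left duality is the dagger of the right duality: $(\iota_X\otimes\mathrm{id}_{X^*})\circ\eta_{X^*}=\epsilon_X^\dagger$ and $\epsilon_{X^*}\circ(\mathrm{id}_{X^*}\otimes\iota_X^{-1})=\eta_X^\dagger$. It is \emph{$\mathbb C$-linear} if the sets of 2-morphisms are complex vector spaces, horizontal and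 vertical composition are bilinear, the dagger is antilinear, and $f^\dagger f=0$ implies $f=0$. An object $s$ is \emph{simple} if $\mathrm{Hom}(\mathrm{id}_s,\mathrm{id}_s)\cong\mathbb C$. \emph{Dagger idempotents split} if every $p: X\to X$ with $p=p^\dagger=p^2$ is of the form $\iota\circ\iota^\dagger$ for some 1-morphism $V$ and isometry $\iota: V\to X$. The left dimension of $X: r\to s$ is $\dim_L(X)=\eta_X^\dagger\circ\eta_X:\mathrm{id}_s\to\mathrm{id}_s$. A 1-morphism $E: t\to s$ is a \emph{dagger equivalence} if there are a 1-morphism $E^{-1}: s\to t$ and unitary 2-morphisms $\mathrm{id}_s\to E^{-1}\otimes E$ and $E\otimes E^{-1}\to\mathrm{id}_t$. Two 1-morphisms $X: r\to s$ and $Y: r\to t$ are \emph{equivalent} if there are a dagger equivalence $E: t\to s$ and a unitary 2-morphism $\tau: X\to Y\otimes E$. A \emph{Frobenius monoid} in $\mathrm{End}(r)$ is a monoid $(A,m,u)$ with $(\mathrm{id}_A\otimes m)(m^\dagger\otimes\mathrm{id}_A)=m^\dagger m=(m\otimes\mathrm{id}_A)(\mathrm{id}_A\otimes m^\dagger)$;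 it is \emph{special} if $mm^\dagger=\mathrm{id}_A$. A \emph{unitary $*$-isomorphism} $(A,m_A,u_A)\to(B,m_B,u_B)$ is a unitary $f: A\to B$ with $f m_A=m_B(f\otimes f)$, $f u_A=u_B$ and $f^\dagger=(\mathrm{id}_A\otimes u_B^\dagger m_B)(\mathrm{id}_A\otimes f\otimes\mathrm{id}_B)(m_A^\dagger u_A\otimes\mathrm{id}_B)$. Theorem. Let $\mathcal C$ be a $\mathbb C$-linear pivotal dagger 2-category in which dagger idempotents split. Let $s,t$ be simple objects, and let $X: r\to s$ and $Y: r\to t$ be 1-morphisms whose left dimensions are positive: $\dim_L(X)=d_X\,\mathrm{id}_s$ and $\dim_L(Y)=d_Y\,\mathrm{id}_t$ with real $d_X,d_Y>0$. Equip $X\otimes X^*$ with the special Frobenius monoid structure in $\mathrm{End}(r)$ with multiplication $\frac{1}{\sqrt{d_X}}\,(\mathrm{id}_X\otimes\eta_X^\dagger\otimes\mathrm{id}_{X^*})$ and unit $\sqrt{d_X}\,\epsilon_X^\dagger$, and likewise $Y\otimes Y^*$. Then $X$ and $Y$ are equivalent if and only if the special Frobenius monoids $X\otimes X^*$ and $Y\otimes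 Y^*$ are unitarily $*$-isomorphic. -/

import Mathlib

universe w v u

open CategoryTheory CategoryTheory.Bicategory

noncomputable section

namespace PivotalDagger

/-! Composition of 1-morphisms `X : r ⟶ s`, `Y : s ⟶ t` is written `X ≫ Y : r ⟶ t`; this is the
composite `X ⊗ Y`, read from left to right. Vertical composition of 2-morphisms is also written in
diagrammatic order, so `f ≫ g` is "first `f`, then `g`". -/

/-! ### Dagger 2-categories -/

/-- A dagger 2-category: every hom-category carries an involutive contravariant identity-on-objects
functor, compatible with horizontal composition, and the coherence isomorphisms are unitary (this is
automatic if the bicategory is strict). -/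
class DaggerBicategory (B : Type u) [Bicategory.{w, v} B] where
  /-- the dagger `f† : Y ⟶ X` of a 2-morphism `f : X ⟶ Y` -/
  dagger : ∀ {a b : B} {X Y : a ⟶ b}, (X ⟶ Y) → (Y ⟶ X)
  dagger_id : ∀ {a b : B} (X : a ⟶ b), dagger (𝟙 X) = 𝟙 X
  dagger_comp : ∀ {a b : B} {X Y Z : a ⟶ b} (f : X ⟶ Y) (g : Y ⟶ Z),
    dagger (f ≫ g) = dagger g ≫ dagger f
  dagger_dagger : ∀ {a b : B} {X Y : a ⟶ b} (f : X ⟶ Y), dagger (dagger f) = f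
  dagger_whiskerLeft : ∀ {a b c : B} (X : a ⟶ b) {Y Z : b ⟶ c} (f : Y ⟶ Z),
    dagger (X ◁ f) = X ◁ dagger f
  dagger_whiskerRight : ∀ {a b c : B} {X Y : a ⟶ b} (f : X ⟶ Y) (Z : b ⟶ c),
    dagger (f ▷ Z) = dagger f ▷ Z
  dagger_associator : ∀ {a b c d : B} (X : a ⟶ b) (Y : b ⟶ c) (Z : c ⟶ d),
    dagger (α_ X Y Z).hom = (α_ X Y Z).inv
  dagger_leftUnitor : ∀ {a b : B} (X : a ⟶ b), dagger (λ_ X).hom = (λ_ X).inv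
  dagger_rightUnitor : ∀ {a b : B} (X : a ⟶ b), dagger (ρ_ X).hom = (ρ_ X).inv


open DaggerBicategory

section Dagger

variable {B : Type u} [Bicategory.{w, v} B] [DaggerBicategory B]

/-- `f† ∘ f = id` -/
def IsIsometry {a b : B} {X Y : a ⟶ b} (f : X ⟶ Y) : Prop := f ≫ dagger f = 𝟙 X

/-- An isometry that is also a coisometry. -/
def IsUnitary {a b : B} {X Y : a ⟶ b} (f : X ⟶ Y) : Prop :=
  IsIsometry f ∧ dagger f ≫ f = 𝟙 Y

/-- `X` is a dagger equivalence: it has a weak inverse, witnessed by unitary 2-morphisms. -/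
def IsDaggerEquivalence {a b : B} (X : a ⟶ b) : Prop :=
  ∃ (Xinv : b ⟶ a) (η : 𝟙 b ⟶ Xinv ≫ X) (e : X ≫ Xinv ⟶ 𝟙 a), IsUnitary η ∧ IsUnitary e

/-- Equivalence of 1-morphisms `X : r ⟶ s` and `Y : r ⟶ t` with the same source. -/
def AreEquivalent {r s t : B} (X : r ⟶ s) (Y : r ⟶ t) : Prop :=
  ∃ E : t ⟶ s, IsDaggerEquivalence E ∧ ∃ τ : X ⟶ Y ≫ E, IsUnitary τ

variable (B) in
/-- Every 2-morphism `p` with `p = p† = p²` is `ι ∘ ι†` for an isometry `ι`. -/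
def HasSplitDaggerIdempotents : Prop :=
  ∀ {a b : B} (X : a ⟶ b) (p : X ⟶ X), dagger p = p → p ≫ p = p →
    ∃ (V : a ⟶ b) (ι : V ⟶ X), IsIsometry ι ∧ dagger ι ≫ ι = p

theorem dagger_associator_inv {a b c d : B} (X : a ⟶ b) (Y : b ⟶ c) (Z : c ⟶ d) :
    dagger (α_ X Y Z).inv = (α_ X Y Z).hom := by
  rw [← dagger_associator, dagger_dagger]

theorem dagger_leftUnitor_inv {a b : B} (X : a ⟶ b) : dagger (λ_ X).inv = (λ_ X).hom := by
  rw [← dagger_leftUnitor, dagger_dagger]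

theorem dagger_rightUnitor_inv {a b : B} (X : a ⟶ b) : dagger (ρ_ X).inv = (ρ_ X).hom := by
  rw [← dagger_rightUnitor, dagger_dagger]

end Dagger

/-! ### Right duals and pivotal 2-categories -/

/-- A 2-category with right duals: every 1-morphism `X : a ⟶ b` has a chosen right dual
`[X*, η, ε]` with `η : 𝟙 b ⟶ X* ≫ X` and `ε : X ≫ X* ⟶ 𝟙 a` satisfying the snake equations, which
are exactly the data of `Bicategory.Adjunction X* X`. -/
class HasRightDuals (B : Type u) [Bicategory.{w, v} B] where
  /-- the chosen right dual `X*` -/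
  dual : ∀ {a b : B}, (a ⟶ b) → (b ⟶ a)
  /-- the cup (unit) and cap (counit) -/
  adj : ∀ {a b : B} (X : a ⟶ b), Bicategory.Adjunction (dual X) X

open HasRightDuals

section Duals

variable {B : Type u} [Bicategory.{w, v} B]

/-- The canonical 2-isomorphism between two right duals of the same 1-morphism, i.e. the mate of the
identity; its inverse is `relate adj₂ adj₁`. -/
def relate {a b : B} {X : a ⟶ b} {L₁ L₂ : b ⟶ a} (adj₁ : Bicategory.Adjunction L₁ X)
    (adj₂ : Bicategory.Adjunction L₂ X) : L₁ ⟶ L₂ :=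
  (conjugateEquiv adj₂ adj₁).symm (𝟙 X)

variable [HasRightDuals B]

/-- The right transpose (mate) `f* : Y* ⟶ X*` of a 2-morphism `f : X ⟶ Y`. -/
def transpose {a b : B} {X Y : a ⟶ b} (f : X ⟶ Y) : dual Y ⟶ dual X :=
  (conjugateEquiv (adj X) (adj Y)).symm f

/-- The multiplicator `X** ⊗ Y** ⟶ (X ⊗ Y)**` of the double duals pseudofunctor, obtained from the
canonical 2-isomorphisms `X** ⊗ Y** ≅ (Y* ⊗ X*)*` and `Y* ⊗ X* ≅ (X ⊗ Y)*`. -/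
def doubleDualMul {a b c : B} (X : a ⟶ b) (Y : b ⟶ c) :
    dual (dual X) ≫ dual (dual Y) ⟶ dual (dual (X ≫ Y)) :=
  relate ((adj (dual X)).comp (adj (dual Y))) (adj (dual Y ≫ dual X)) ≫
    transpose (relate (adj (X ≫ Y)) ((adj Y).comp (adj X)))

/-- The unitor `𝟙 ⟶ 𝟙**` of the double duals pseudofunctor, obtained from the canonical
2-isomorphism between the right duals `𝟙` and `𝟙*` of `𝟙`. -/
def doubleDualUnit (a : B) : 𝟙 a ⟶ dual (dual (𝟙 a)) :=
  relate (Bicategory.Adjunction.id a) (adj (𝟙 a)) ≫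
    transpose (relate (adj (𝟙 a)) (Bicategory.Adjunction.id a))

end Duals

/-- A pivotal 2-category: a 2-category with right duals and an invertible icon `ι` from the double
duals pseudofunctor to the identity pseudofunctor. -/
class PivotalBicategory (B : Type u) [Bicategory.{w, v} B] extends HasRightDuals B where
  /-- the components `ι_X : X** ≅ X` -/
  pivot : ∀ {a b : B} (X : a ⟶ b), dual (dual X) ≅ X
  pivot_naturality : ∀ {a b : B} {X Y : a ⟶ b} (f : X ⟶ Y),
    transpose (transpose f) ≫ (pivot Y).hom = (pivot X).hom ≫ f
  pivot_comp : ∀ {a b c : B} (X : a ⟶ b) (Y : b ⟶ c),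
    doubleDualMul X Y ≫ (pivot (X ≫ Y)).hom =
      (pivot X).hom ▷ dual (dual Y) ≫ X ◁ (pivot Y).hom
  pivot_id : ∀ a : B, doubleDualUnit a ≫ (pivot (𝟙 a)).hom = 𝟙 (𝟙 a)

open PivotalBicategory

section Pivotal

variable {B : Type u} [Bicategory.{w, v} B] [PivotalBicategory B]

/-- The cup of the left duality, `𝟙 r ⟶ X ⊗ X*`. -/
def leftCup {r s : B} (X : r ⟶ s) : 𝟙 r ⟶ X ≫ dual X :=
  (adj (dual X)).unit ≫ (pivot X).hom ▷ dual X

/-- The cap of the left duality, `X* ⊗ X ⟶ 𝟙 s`. -/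
def leftCap {r s : B} (X : r ⟶ s) : dual X ≫ X ⟶ 𝟙 s :=
  dual X ◁ (pivot X).inv ≫ (adj (dual X)).counit

/-- `X*` is a left dual of `X`. -/
def leftAdj {r s : B} (X : r ⟶ s) : Bicategory.Adjunction X (dual X) where
  unit := leftCup X
  counit := leftCap X
  left_triangle := by
    have h := (adj (dual X)).left_triangle
    unfold leftZigzag at h ⊢
    unfold leftCup leftCap
    calc _ = (adj (dual X)).unit ▷ X ⊗≫ ((pivot X).hom ▷ (dual X ≫ X) ≫
              X ◁ (dual X ◁ (pivot X).inv)) ⊗≫ X ◁ (adj (dual X)).counit := by bicategory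
      _ = 𝟙 _ ⊗≫ ((adj (dual X)).unit ▷ X ≫ (dual (dual X) ≫ dual X) ◁ (pivot X).inv) ⊗≫
            ((pivot X).hom ▷ (dual X ≫ dual (dual X)) ≫ X ◁ (adj (dual X)).counit) ⊗≫ 𝟙 _ := by
          rw [← whisker_exchange]; bicategory
      _ = 𝟙 _ ⊗≫ (pivot X).inv ⊗≫ ((adj (dual X)).unit ▷ dual (dual X) ⊗≫
            dual (dual X) ◁ (adj (dual X)).counit) ⊗≫ (pivot X).hom ⊗≫ 𝟙 _ := by
          rw [← whisker_exchange, ← whisker_exchange]; bicategory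
      _ = 𝟙 _ ⊗≫ ((pivot X).inv ≫ (pivot X).hom) ⊗≫ 𝟙 _ := by rw [h]; bicategory
      _ = _ := by rw [Iso.inv_hom_id]; bicategory
  right_triangle := by
    have h := (adj (dual X)).right_triangle
    unfold rightZigzag at h ⊢
    unfold leftCup leftCap
    calc _ = dual X ◁ (adj (dual X)).unit ⊗≫ dual X ◁ ((pivot X).hom ≫ (pivot X).inv) ▷ dual X ⊗≫
              (adj (dual X)).counit ▷ dual X := by bicategory
      _ = dual X ◁ (adj (dual X)).unit ⊗≫ (adj (dual X)).counit ▷ dual X := by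
          rw [Iso.hom_inv_id]; bicategory
      _ = _ := h

/-- The left dimension of `X : r ⟶ s`: the right cup followed by the left cap. -/
def leftDim {r s : B} (X : r ⟶ s) : 𝟙 s ⟶ 𝟙 s := (adj X).unit ≫ leftCap X

/-- The multiplication `id_X ⊗ (left cap) ⊗ id_{X*}` on `X ⊗ X*`, before normalisation. -/
def pairMul {r s : B} (X : r ⟶ s) : (X ≫ dual X) ≫ (X ≫ dual X) ⟶ X ≫ dual X :=
  (α_ X (dual X) (X ≫ dual X)).hom ≫
    X ◁ ((α_ (dual X) X (dual X)).inv ≫ leftCap X ▷ dual X ≫ (λ_ (dual X)).hom)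

theorem pairMul_assoc {r s : B} (X : r ⟶ s) :
    pairMul X ▷ (X ≫ dual X) ≫ pairMul X =
      (α_ _ _ _).hom ≫ (X ≫ dual X) ◁ pairMul X ≫ pairMul X := by
  unfold pairMul
  calc _ = 𝟙 _ ⊗≫ X ◁ (leftCap X ▷ (dual X ≫ X) ≫ 𝟙 s ◁ leftCap X) ▷ dual X ⊗≫ 𝟙 _ := by
        bicategory
    _ = _ := by rw [← whisker_exchange]; bicategory

theorem leftCup_pairMul {r s : B} (X : r ⟶ s) :
    leftCup X ▷ (X ≫ dual X) ≫ pairMul X = (λ_ _).hom := by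
  have h := (leftAdj X).left_triangle
  unfold leftZigzag at h
  change leftCup X ▷ X ⊗≫ X ◁ leftCap X = _ at h
  unfold pairMul
  calc _ = 𝟙 _ ⊗≫ (leftCup X ▷ X ⊗≫ X ◁ leftCap X) ▷ dual X ⊗≫ 𝟙 _ := by bicategory
    _ = _ := by rw [h]; bicategory

theorem pairMul_leftCup {r s : B} (X : r ⟶ s) :
    (X ≫ dual X) ◁ leftCup X ≫ pairMul X = (ρ_ _).hom := by
  have h := (leftAdj X).right_triangle
  unfold rightZigzag at h
  change dual X ◁ leftCup X ⊗≫ leftCap X ▷ dual X = _ at h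
  unfold pairMul
  calc _ = 𝟙 _ ⊗≫ X ◁ (dual X ◁ leftCup X ⊗≫ leftCap X ▷ dual X) ⊗≫ 𝟙 _ := by bicategory
    _ = _ := by rw [h]; bicategory

end Pivotal

/-- A pivotal dagger 2-category: the left duality determined by the pivotal structure is the dagger
of the right duality. -/
class PivotalDaggerBicategory (B : Type u) [Bicategory.{w, v} B] [DaggerBicategory B]
    [PivotalBicategory B] : Prop where
  leftCup_eq : ∀ {r s : B} (X : r ⟶ s), leftCup X = dagger (adj X).counit
  leftCap_eq : ∀ {r s : B} (X : r ⟶ s), leftCap X = dagger (adj X).unit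

/-! ### Linearity -/

/-- A `ℂ`-linear dagger 2-category: the 2-morphisms form complex vector spaces and vertical
composition is bilinear (`Preadditive`, `Linear`), horizontal composition is bilinear, the dagger is
antilinear, and `f† ∘ f = 0` implies `f = 0`. -/
class LinearDaggerBicategory (B : Type u) [Bicategory.{w, v} B] [DaggerBicategory B]
    [∀ a b : B, Preadditive (a ⟶ b)] [∀ a b : B, Linear ℂ (a ⟶ b)] : Prop where
  whiskerLeft_add : ∀ {a b c : B} (X : a ⟶ b) {Y Z : b ⟶ c} (f g : Y ⟶ Z),
    X ◁ (f + g) = X ◁ f + X ◁ g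
  whiskerLeft_smul : ∀ {a b c : B} (X : a ⟶ b) {Y Z : b ⟶ c} (z : ℂ) (f : Y ⟶ Z),
    X ◁ (z • f) = z • (X ◁ f)
  add_whiskerRight : ∀ {a b c : B} {X Y : a ⟶ b} (f g : X ⟶ Y) (Z : b ⟶ c),
    (f + g) ▷ Z = f ▷ Z + g ▷ Z
  smul_whiskerRight : ∀ {a b c : B} {X Y : a ⟶ b} (z : ℂ) (f : X ⟶ Y) (Z : b ⟶ c),
    (z • f) ▷ Z = z • (f ▷ Z)
  dagger_add : ∀ {a b : B} {X Y : a ⟶ b} (f g : X ⟶ Y), dagger (f + g) = dagger f + dagger g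
  dagger_smul : ∀ {a b : B} {X Y : a ⟶ b} (z : ℂ) (f : X ⟶ Y),
    dagger (z • f) = (starRingEnd ℂ z) • dagger f
  eq_zero_of_comp_dagger : ∀ {a b : B} {X Y : a ⟶ b} (f : X ⟶ Y), f ≫ dagger f = 0 → f = 0

open LinearDaggerBicategory

/-- The object `r` is simple: `Hom(𝟙 r, 𝟙 r) ≅ ℂ`. -/
def IsSimpleObj {B : Type u} [Bicategory.{w, v} B] [∀ a b : B, Preadditive (a ⟶ b)]
    [∀ a b : B, Linear ℂ (a ⟶ b)] (r : B) : Prop :=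
  Nonempty ((𝟙 r ⟶ 𝟙 r) ≃ₗ[ℂ] ℂ)

/-! ### Frobenius monoids -/

/-- A Frobenius monoid in the monoidal dagger category `End(r)`. -/
structure FrobeniusMonoid {B : Type u} [Bicategory.{w, v} B] [DaggerBicategory B] (r : B) where
  /-- the underlying object -/
  obj : r ⟶ r
  /-- the multiplication -/
  mul : obj ≫ obj ⟶ obj
  /-- the unit -/
  one : 𝟙 r ⟶ obj
  mul_assoc : mul ▷ obj ≫ mul = (α_ obj obj obj).hom ≫ obj ◁ mul ≫ mul
  one_mul : one ▷ obj ≫ mul = (λ_ obj).hom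
  mul_one : obj ◁ one ≫ mul = (ρ_ obj).hom
  frobenius_left : obj ◁ dagger mul ≫ (α_ obj obj obj).inv ≫ mul ▷ obj = mul ≫ dagger mul
  frobenius_right : dagger mul ▷ obj ≫ (α_ obj obj obj).hom ≫ obj ◁ mul = mul ≫ dagger mul

section Frobenius

variable {B : Type u} [Bicategory.{w, v} B] [DaggerBicategory B] {r : B}

/-- A Frobenius monoid is special if `m ∘ m† = id`. -/
def FrobeniusMonoid.IsSpecial (A : FrobeniusMonoid r) : Prop := dagger A.mul ≫ A.mul = 𝟙 A.obj

/-- `f : A ⟶ A'` is a `*`-homomorphism: it preserves multiplication and unit, and its dagger is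
obtained by bending the legs of `f` with the Frobenius cup `m† ∘ u` of `A` and cap `u† ∘ m` of
`A'`. -/
structure IsStarHom (A A' : FrobeniusMonoid r) (f : A.obj ⟶ A'.obj) : Prop where
  map_mul : A.mul ≫ f = f ▷ A.obj ≫ A'.obj ◁ f ≫ A'.mul
  map_one : A.one ≫ f = A'.one
  map_star : dagger f =
    (λ_ A'.obj).inv ≫ (A.one ≫ dagger A.mul) ▷ A'.obj ≫ (α_ A.obj A.obj A'.obj).hom ≫
      A.obj ◁ (f ▷ A'.obj ≫ A'.mul ≫ dagger A'.one) ≫ (ρ_ A.obj).hom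

/-- There is a unitary `*`-isomorphism between `A` and `A'`. -/
def UnitarilyStarIsomorphic (A A' : FrobeniusMonoid r) : Prop :=
  ∃ f : A.obj ⟶ A'.obj, IsUnitary f ∧ IsStarHom A A' f

end Frobenius

section Morita

variable {B : Type u} [Bicategory.{w, v} B] [DaggerBicategory B] [PivotalBicategory B]

theorem dagger_pairMul {r s : B} (X : r ⟶ s) : dagger (pairMul X) =
    X ◁ ((λ_ (dual X)).inv ≫ dagger (leftCap X) ▷ dual X ≫ (α_ (dual X) X (dual X)).hom) ≫
      (α_ X (dual X) (X ≫ dual X)).inv := by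
  simp only [pairMul, dagger_comp, dagger_whiskerLeft, dagger_whiskerRight, dagger_associator,
    dagger_associator_inv, dagger_leftUnitor, Category.assoc]

theorem pairMul_frobenius_left {r s : B} (X : r ⟶ s) :
    (X ≫ dual X) ◁ dagger (pairMul X) ≫ (α_ _ _ _).inv ≫ pairMul X ▷ (X ≫ dual X) =
      pairMul X ≫ dagger (pairMul X) := by
  rw [dagger_pairMul]
  unfold pairMul
  calc _ = 𝟙 _ ⊗≫ X ◁ ((dual X ≫ X) ◁ dagger (leftCap X) ≫ leftCap X ▷ (dual X ≫ X)) ▷ dual X ⊗≫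
            𝟙 _ := by bicategory
    _ = _ := by rw [whisker_exchange]; bicategory

theorem pairMul_frobenius_right {r s : B} (X : r ⟶ s) :
    dagger (pairMul X) ▷ (X ≫ dual X) ≫ (α_ _ _ _).hom ≫ (X ≫ dual X) ◁ pairMul X =
      pairMul X ≫ dagger (pairMul X) := by
  rw [dagger_pairMul]
  unfold pairMul
  calc _ = 𝟙 _ ⊗≫ X ◁ (dagger (leftCap X) ▷ (dual X ≫ X) ≫ (dual X ≫ X) ◁ leftCap X) ▷ dual X ⊗≫
            𝟙 _ := by bicategory
    _ = _ := by rw [← whisker_exchange]; bicategory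

variable [∀ a b : B, Preadditive (a ⟶ b)] [∀ a b : B, Linear ℂ (a ⟶ b)] [LinearDaggerBicategory B]

/-- The Frobenius monoid `X ⊗ X*` in `End(r)`, for a 1-morphism `X : r ⟶ s` and a scalar `d > 0`,
with multiplication `d^(-1/2) • (id_X ⊗ (left cap) ⊗ id_{X*})` and unit `d^(1/2) • (left cup)`. It is
used for the scalar `d = d_X` with `dim_L(X) = d_X • id_s`, for which it is special. -/
def pairFrobenius {r s : B} (X : r ⟶ s) (d : ℝ) (hd : 0 < d) : FrobeniusMonoid r where
  obj := X ≫ dual X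
  mul := (((Real.sqrt d)⁻¹ : ℝ) : ℂ) • pairMul X
  one := ((Real.sqrt d : ℝ) : ℂ) • leftCup X
  mul_assoc := by
    simp only [smul_whiskerRight, whiskerLeft_smul, Linear.smul_comp, Linear.comp_smul,
      pairMul_assoc]
  one_mul := by
    have : ((Real.sqrt d : ℝ) : ℂ) ≠ 0 := by exact_mod_cast (Real.sqrt_pos.2 hd).ne'
    simp only [smul_whiskerRight, Linear.smul_comp, Linear.comp_smul, leftCup_pairMul, smul_smul]
    simp [this]
  mul_one := by
    have : ((Real.sqrt d : ℝ) : ℂ) ≠ 0 := by exact_mod_cast (Real.sqrt_pos.2 hd).ne'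
    simp only [whiskerLeft_smul, Linear.smul_comp, Linear.comp_smul, pairMul_leftCup, smul_smul]
    simp [this]
  frobenius_left := by
    simp only [dagger_smul, smul_whiskerRight, whiskerLeft_smul, Linear.smul_comp,
      Linear.comp_smul, pairMul_frobenius_left, Complex.conj_ofReal]
  frobenius_right := by
    simp only [dagger_smul, smul_whiskerRight, whiskerLeft_smul, Linear.smul_comp,
      Linear.comp_smul, pairMul_frobenius_right, Complex.conj_ofReal]

/-- `X ⊗ X*` is a special Frobenius monoid if `d` is the scalar with `dim_L(X) = d • id_s`. -/
theorem pairFrobenius_isSpecial [PivotalDaggerBicategory B] {r s : B} (X : r ⟶ s) (d : ℝ)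
    (hd : 0 < d) (hX : leftDim X = (d : ℂ) • 𝟙 (𝟙 s)) : (pairFrobenius X d hd).IsSpecial := by
  have h1 : dagger (leftCap X) ≫ leftCap X = (d : ℂ) • 𝟙 (𝟙 s) := by
    rw [← hX, leftDim, PivotalDaggerBicategory.leftCap_eq, dagger_dagger]
  have h2 : dagger (pairMul X) ≫ pairMul X = (d : ℂ) • 𝟙 (X ≫ dual X) := by
    rw [dagger_pairMul]
    unfold pairMul
    calc _ = 𝟙 _ ⊗≫ X ◁ (dagger (leftCap X) ≫ leftCap X) ▷ dual X ⊗≫ 𝟙 _ := by bicategory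
      _ = (d : ℂ) • (𝟙 _ ⊗≫ X ◁ (𝟙 (𝟙 s)) ▷ dual X ⊗≫ 𝟙 _) := by
          rw [h1]
          simp only [bicategoricalComp, whiskerLeft_smul, smul_whiskerRight, Linear.smul_comp,
            Linear.comp_smul]
      _ = _ := by congr 1; bicategory
  have h3 : (((Real.sqrt d)⁻¹ : ℝ) : ℂ) * (((Real.sqrt d)⁻¹ : ℝ) : ℂ) * (d : ℂ) = 1 := by
    have := Real.mul_self_sqrt hd.le
    have h4 := (Real.sqrt_pos.2 hd).ne'
    have : (Real.sqrt d)⁻¹ * (Real.sqrt d)⁻¹ * d = 1 := by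
      rw [← mul_inv, this, inv_mul_cancel₀ hd.ne']
    exact_mod_cast this
  change dagger ((((Real.sqrt d)⁻¹ : ℝ) : ℂ) • pairMul X) ≫
    ((((Real.sqrt d)⁻¹ : ℝ) : ℂ) • pairMul X) = 𝟙 (X ≫ dual X)
  rw [dagger_smul, Complex.conj_ofReal, Linear.smul_comp, Linear.comp_smul, h2, smul_smul,
    smul_smul, h3, one_smul]

end Morita

end PivotalDagger

end

open PivotalDagger

open DaggerBicategory HasRightDuals PivotalBicategory LinearDaggerBicategory

/-! This is a Morita-type argument. The algebra `X ⊗ X*` remembers `X` up to an equivalence of its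
target.

From an algebra isomorphism to an equivalence: rescale it to an isomorphism `g` of the unnormalised
algebras, with inverse `h` and `g† = (dX / dY) • h` (`IsPairIso`). Through `g` the algebra `X ⊗ X*`
acts on `Y*` from the right, and `E` is the relative tensor product of `Y*` and `X` over it, cut out
of `Y* ⊗ X` by a dagger idempotent proportional to `relProj`. The Frobenius law makes this a
projection (`relProj_comp_relProj'`). Exchanging `X` and `Y` gives `E'`. The product of the two
projections factors through `𝟙 t` (`relProj_whisker_relProj'`), so `E ⊗ E'` is unitarily `𝟙 t`, and
symmetrically for `E' ⊗ E`. Inserting a cup of `Y` and compressing to `E` gives the unitary `X ⟶ Y ⊗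
E` (`exists_unitary_comp`).

From an equivalence to an algebra isomorphism: a unitary `X ⟶ Y ⊗ E` identifies `X ⊗ X*` with `Y ⊗ E
⊗ E* ⊗ Y*`. This needs the canonical comparison of `(Y ⊗ E)*` with `E* ⊗ Y*` to respect daggers,
which comes from the monoidality of the pivot (`leftCup_comp`). Simplicity of `s` and `t` leaves
only scalar endomorphisms of `E* ⊗ E`, so the caps of `E` are unitary up to a scalar
(`isInvertibleDual`), and capping off `E ⊗ E*` with the factor `√(dX / dY)` is the required map. Its
compatibility with stars is automatic (`isStarHom_of_isUnitary`). -/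

namespace PivotalDagger

set_option linter.unusedSectionVars false

/-! ### The projection defining the relative tensor product -/

section Projection

variable {B : Type u} [Bicategory.{w, v} B] [DaggerBicategory B] [PivotalBicategory B]

section Cups

variable [PivotalDaggerBicategory B]

theorem dagger_unit {r s : B} (X : r ⟶ s) : dagger (adj X).unit = leftCap X :=
  (PivotalDaggerBicategory.leftCap_eq X).symm

theorem dagger_counit {r s : B} (X : r ⟶ s) : dagger (adj X).counit = leftCup X :=
  (PivotalDaggerBicategory.leftCup_eq X).symm

theorem dagger_leftCap {r s : B} (X : r ⟶ s) : dagger (leftCap X) = (adj X).unit := by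
  rw [← dagger_unit, dagger_dagger]

theorem dagger_leftCup {r s : B} (X : r ⟶ s) : dagger (leftCup X) = (adj X).counit := by
  rw [← dagger_counit, dagger_dagger]

end Cups

theorem unit_zigzag {r s : B} (X : r ⟶ s) :
    X ◁ (adj X).unit ⊗≫ (adj X).counit ▷ X = (ρ_ X).hom ≫ (λ_ X).inv :=
  (adj X).right_triangle

theorem leftCup_zigzag {r s : B} (X : r ⟶ s) :
    leftCup X ▷ X ⊗≫ X ◁ leftCap X = (λ_ X).hom ≫ (ρ_ X).inv :=
  (leftAdj X).left_triangle

/-- The unnormalised projection of `Y* ⊗ X` onto the relative tensor product over `X ⊗ X*`. -/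
def relProj {r s t : B} (X : r ⟶ s) (Y : r ⟶ t) (g : X ≫ dual X ⟶ Y ≫ dual Y) :
    dual Y ≫ X ⟶ dual Y ≫ X :=
  𝟙 _ ⊗≫ (dual Y ≫ X) ◁ (adj X).unit ⊗≫ dual Y ◁ g ▷ X ⊗≫ leftCap Y ▷ (dual Y ≫ X) ⊗≫ 𝟙 _

/-- The adjoint form of `relProj`. -/
def relProj' {r s t : B} (X : r ⟶ s) (Y : r ⟶ t) (h : Y ≫ dual Y ⟶ X ≫ dual X) :
    dual Y ≫ X ⟶ dual Y ≫ X :=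
  𝟙 _ ⊗≫ (adj Y).unit ▷ (dual Y ≫ X) ⊗≫ dual Y ◁ h ▷ X ⊗≫ (dual Y ≫ X) ◁ leftCap X ⊗≫ 𝟙 _

theorem dagger_relProj [PivotalDaggerBicategory B] {r s t : B} (X : r ⟶ s) (Y : r ⟶ t)
    (g : X ≫ dual X ⟶ Y ≫ dual Y) : dagger (relProj X Y g) = relProj' X Y (dagger g) := by
  simp only [relProj, relProj', bicategoricalComp, dagger_comp, dagger_whiskerLeft,
    dagger_whiskerRight, dagger_associator, dagger_id, dagger_associator_inv, dagger_leftUnitor,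
    Category.assoc, dagger_unit, dagger_leftCap, BicategoricalCoherence.iso, Iso.trans_hom,
    whiskerLeftIso_hom, whiskerRightIso_hom, Iso.symm_hom, Iso.refl_hom, dagger_rightUnitor_inv]

/-- Multiplicativity of `g` turns its two successive applications into one application after
multiplying in `X ⊗ X*`, which leaves only a cap and a cup of `X`. -/
theorem whisker_relProj {r s t : B} (X : r ⟶ s) (Y : r ⟶ t) (g : X ≫ dual X ⟶ Y ≫ dual Y)
    (hg : pairMul X ≫ g = g ▷ (X ≫ dual X) ≫ (Y ≫ dual Y) ◁ g ≫ pairMul Y) :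
    g ▷ X ⊗≫ Y ◁ relProj X Y g = 𝟙 _ ⊗≫ X ◁ (leftCap X ≫ (adj X).unit) ⊗≫ g ▷ X ⊗≫ 𝟙 _ := by
  unfold relProj
  unfold pairMul at hg
  calc _ = 𝟙 _ ⊗≫ (g ▷ X ▷ 𝟙 s ≫ ((Y ≫ dual Y) ≫ X) ◁ (adj X).unit) ⊗≫
            (Y ≫ dual Y) ◁ g ▷ X ⊗≫ Y ◁ leftCap Y ▷ (dual Y ≫ X) ⊗≫ 𝟙 _ := by bicategory
    _ = 𝟙 _ ⊗≫ ((X ≫ dual X) ≫ X) ◁ (adj X).unit ⊗≫ (g ▷ (X ≫ dual X) ≫ (Y ≫ dual Y) ◁ g ≫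
          (α_ Y (dual Y) (Y ≫ dual Y)).hom ≫ Y ◁ ((α_ (dual Y) Y (dual Y)).inv ≫
            leftCap Y ▷ dual Y ≫ (λ_ (dual Y)).hom)) ▷ X ⊗≫ 𝟙 _ := by
          rw [← whisker_exchange]; bicategory
    _ = 𝟙 _ ⊗≫ X ◁ ((dual X ≫ X) ◁ (adj X).unit ≫ leftCap X ▷ (dual X ≫ X)) ⊗≫ g ▷ X ⊗≫ 𝟙 _ := by
          rw [← hg]; bicategory
    _ = _ := by rw [whisker_exchange]; bicategory

variable [∀ a b : B, Preadditive (a ⟶ b)] [∀ a b : B, Linear ℂ (a ⟶ b)] [LinearDaggerBicategory B]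

/-- An isomorphism of the unnormalised monoids `X ⊗ X*` and `Y ⊗ Y*` with inverse `h` that is
unitary up to the scalar `c`. -/
structure IsPairIso {r s t : B} (X : r ⟶ s) (Y : r ⟶ t) (c : ℝ) (g : X ≫ dual X ⟶ Y ≫ dual Y)
    (h : Y ≫ dual Y ⟶ X ≫ dual X) : Prop where
  scalar_ne_zero : c ≠ 0
  hom_inv : g ≫ h = 𝟙 _
  inv_hom : h ≫ g = 𝟙 _
  dagger_eq : dagger g = (c : ℂ) • h
  map_mul : pairMul X ≫ g = g ▷ (X ≫ dual X) ≫ (Y ≫ dual Y) ◁ g ≫ pairMul Y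
  map_one : leftCup X ≫ g = leftCup Y

namespace IsPairIso

variable {r s t : B} {X : r ⟶ s} {Y : r ⟶ t} {c : ℝ} {g : X ≫ dual X ⟶ Y ≫ dual Y}
  {h : Y ≫ dual Y ⟶ X ≫ dual X}

theorem dagger_inv (H : IsPairIso X Y c g h) : dagger h = ((c⁻¹ : ℝ) : ℂ) • g := by
  have hc : (c : ℂ) ≠ 0 := by exact_mod_cast H.scalar_ne_zero
  have h1 : g = (c : ℂ) • dagger h := by
    rw [← dagger_dagger g, H.dagger_eq, dagger_smul, Complex.conj_ofReal]
  rw [h1, smul_smul]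
  simp [hc]

/-- Lets each later lemma serve for both `E` and its inverse `E'`. -/
theorem symm (H : IsPairIso X Y c g h) : IsPairIso Y X c⁻¹ h g where
  scalar_ne_zero := inv_ne_zero H.scalar_ne_zero
  hom_inv := H.inv_hom
  inv_hom := H.hom_inv
  dagger_eq := H.dagger_inv
  map_mul := by
    have h1 : (h ▷ (Y ≫ dual Y) ≫ (X ≫ dual X) ◁ h) ≫
        (g ▷ (X ≫ dual X) ≫ (Y ≫ dual Y) ◁ g) = 𝟙 _ := by
      rw [Category.assoc, whisker_exchange_assoc, ← Bicategory.comp_whiskerRight_assoc,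
        ← Bicategory.whiskerLeft_comp, H.inv_hom]
      simp
    calc pairMul Y ≫ h = (h ▷ (Y ≫ dual Y) ≫ (X ≫ dual X) ◁ h) ≫
          (g ▷ (X ≫ dual X) ≫ (Y ≫ dual Y) ◁ g ≫ pairMul Y) ≫ h := by
            rw [← Category.id_comp (pairMul Y ≫ h), ← h1]; simp only [Category.assoc]
      _ = _ := by rw [← H.map_mul]; simp only [Category.assoc, H.hom_inv, Category.comp_id]
  map_one := by rw [← H.map_one, Category.assoc, H.hom_inv, Category.comp_id]

/-- The dagger of unit preservation by `h`; the scalar comes from `h†` being `c⁻¹ • g`. -/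
theorem comp_counit [PivotalDaggerBicategory B] (H : IsPairIso X Y c g h) :
    g ≫ (adj Y).counit = (c : ℂ) • (adj X).counit := by
  have h1 := congrArg dagger H.symm.map_one
  have hc : (c : ℂ) ≠ 0 := by exact_mod_cast H.scalar_ne_zero
  rw [dagger_comp, dagger_leftCup, dagger_leftCup, H.dagger_inv, Linear.smul_comp] at h1
  rw [← h1, smul_smul]
  simp [hc]

/-- Taking the dagger of multiplicativity shows that `h` respects comultiplication up to `c`.
Cancelling one leg gives this form, in which `g` on the left leg is traded for `h` on the right leg.
-/
theorem comul_left (H : IsPairIso X Y c g h) : dagger (pairMul X) ≫ g ▷ (X ≫ dual X) =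
    (c : ℂ) • (g ≫ dagger (pairMul Y) ≫ (Y ≫ dual Y) ◁ h) := by
  have hc : (c : ℂ) ≠ 0 := by exact_mod_cast H.scalar_ne_zero
  have h1 := congrArg dagger H.map_mul
  simp only [dagger_comp, dagger_whiskerLeft, dagger_whiskerRight, H.dagger_eq, whiskerLeft_smul,
    smul_whiskerRight, Linear.smul_comp, Linear.comp_smul, Category.assoc] at h1
  have h2 := smul_right_injective _ hc h1
  calc _ = g ≫ (h ≫ dagger (pairMul X)) ≫ g ▷ (X ≫ dual X) := by
        rw [Category.assoc, ← Category.assoc, H.hom_inv, Category.id_comp]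
    _ = _ := by
      rw [h2]
      simp only [Linear.smul_comp, Linear.comp_smul, Category.assoc,
        ← Bicategory.comp_whiskerRight, H.inv_hom, Bicategory.id_whiskerRight, Category.comp_id]

theorem comul_right (H : IsPairIso X Y c g h) : dagger (pairMul X) ≫ (X ≫ dual X) ◁ g =
    (c : ℂ) • (g ≫ dagger (pairMul Y) ≫ h ▷ (Y ≫ dual Y)) := by
  calc _ = (dagger (pairMul X) ≫ g ▷ (X ≫ dual X)) ≫ (Y ≫ dual Y) ◁ g ≫ h ▷ (Y ≫ dual Y) := by
        rw [whisker_exchange, Category.assoc, ← Bicategory.comp_whiskerRight_assoc, H.hom_inv,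
          Bicategory.id_whiskerRight, Category.id_comp]
    _ = _ := by
      rw [H.comul_left]
      simp only [Linear.smul_comp, Category.assoc, ← Bicategory.whiskerLeft_comp_assoc, H.inv_hom,
        Bicategory.whiskerLeft_id, Category.id_comp]

/-- `relProj` contains the comultiplication of `X ⊗ X*` with `g` on its left leg, once the extra cap
is slid past the cup. `comul_left` moves the action to the right leg as `h`, which is the shape of
`relProj'`. -/
theorem leftCap_comp_relProj [PivotalDaggerBicategory B] (H : IsPairIso X Y c g h) :
    𝟙 ((dual Y ≫ X) ≫ (dual X ≫ X)) ⊗≫ (dual Y ≫ X) ◁ leftCap X ⊗≫ relProj X Y g =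
      (c : ℂ) • (𝟙 _ ⊗≫ dual Y ◁ g ▷ X ⊗≫ leftCap Y ▷ (dual Y ≫ X) ⊗≫ relProj' X Y h) := by
  have h1 := H.comul_left
  rw [dagger_pairMul, dagger_pairMul, dagger_leftCap, dagger_leftCap] at h1
  unfold relProj relProj'
  calc _ = 𝟙 _ ⊗≫ (dual Y ≫ X) ◁ (𝟙 s ◁ leftCap X ≫ (adj X).unit ▷ 𝟙 s) ⊗≫
            dual Y ◁ g ▷ X ⊗≫ leftCap Y ▷ (dual Y ≫ X) ⊗≫ 𝟙 _ := by bicategory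
    _ = 𝟙 _ ⊗≫ (dual Y ≫ X) ◁ (adj X).unit ▷ (dual X ≫ X) ⊗≫ dual Y ◁ (
          ((X ≫ dual X) ≫ X) ◁ leftCap X ≫ g ▷ X ▷ 𝟙 s) ⊗≫
            leftCap Y ▷ (dual Y ≫ X) ⊗≫ 𝟙 _ := by
          rw [whisker_exchange]; bicategory
    _ = 𝟙 _ ⊗≫ dual Y ◁ ((X ◁ ((λ_ (dual X)).inv ≫ (adj X).unit ▷ dual X ≫
          (α_ (dual X) X (dual X)).hom) ≫ (α_ X (dual X) (X ≫ dual X)).inv) ≫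
            g ▷ (X ≫ dual X)) ▷ X ⊗≫
          ((dual Y ≫ Y) ◁ (dual Y ≫ X) ◁ leftCap X ≫
            leftCap Y ▷ ((dual Y ≫ X) ≫ 𝟙 s)) ⊗≫ 𝟙 _ := by
          rw [whisker_exchange]; bicategory
    _ = (c : ℂ) • (𝟙 _ ⊗≫ dual Y ◁ (g ≫ (Y ◁ ((λ_ (dual Y)).inv ≫ (adj Y).unit ▷ dual Y ≫
          (α_ (dual Y) Y (dual Y)).hom) ≫ (α_ Y (dual Y) (Y ≫ dual Y)).inv) ≫
            (Y ≫ dual Y) ◁ h) ▷ X ⊗≫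
          (leftCap Y ▷ ((dual Y ≫ X) ≫ (dual X ≫ X)) ≫
            𝟙 t ◁ (dual Y ≫ X) ◁ leftCap X) ⊗≫ 𝟙 _) := by
          rw [h1, whisker_exchange]
          simp only [bicategoricalComp, whiskerLeft_smul, smul_whiskerRight, Linear.smul_comp,
            Linear.comp_smul]
    _ = (c : ℂ) • (𝟙 _ ⊗≫ dual Y ◁ g ▷ X ⊗≫ dual Y ◁ Y ◁ (adj Y).unit ▷ (dual Y ≫ X) ⊗≫
          ((dual Y ≫ Y) ◁ (dual Y ◁ h ▷ X) ≫
            leftCap Y ▷ (dual Y ≫ (X ≫ dual X) ≫ X)) ⊗≫ (dual Y ≫ X) ◁ leftCap X ⊗≫ 𝟙 _) := by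
          congr 1; bicategory
    _ = (c : ℂ) • (𝟙 _ ⊗≫ dual Y ◁ g ▷ X ⊗≫
          ((dual Y ≫ Y) ◁ (adj Y).unit ▷ (dual Y ≫ X) ≫
            leftCap Y ▷ ((dual Y ≫ Y) ≫ (dual Y ≫ X))) ⊗≫ dual Y ◁ h ▷ X ⊗≫
              (dual Y ≫ X) ◁ leftCap X ⊗≫ 𝟙 _) := by
          rw [whisker_exchange]; congr 1; bicategory
    _ = _ := by rw [whisker_exchange]; congr 1; bicategory

/-- Precomposing `leftCap_comp_relProj` with a cup of `X` closes a loop of value `d` on one side and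
creates `relProj` on the other. -/
theorem relProj_comp_relProj' [PivotalDaggerBicategory B] (H : IsPairIso X Y c g h) {d : ℂ}
    (hX : leftDim X = d • 𝟙 (𝟙 s)) :
    (c : ℂ) • (relProj X Y g ≫ relProj' X Y h) = d • relProj X Y g := by
  have h1 := H.leftCap_comp_relProj
  calc _ = 𝟙 _ ⊗≫ (dual Y ≫ X) ◁ (adj X).unit ⊗≫ ((c : ℂ) •
            (𝟙 ((dual Y ≫ X) ≫ (dual X ≫ X)) ⊗≫ dual Y ◁ g ▷ X ⊗≫
            leftCap Y ▷ (dual Y ≫ X) ⊗≫ relProj' X Y h)) := by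
          conv_lhs => unfold relProj
          simp only [bicategoricalComp, Linear.comp_smul]
          congr 1; bicategory
    _ = 𝟙 _ ⊗≫ (dual Y ≫ X) ◁ ((adj X).unit ≫ leftCap X) ⊗≫ relProj X Y g := by
          rw [← h1]; bicategory
    _ = d • (𝟙 _ ⊗≫ (dual Y ≫ X) ◁ 𝟙 (𝟙 s) ⊗≫ relProj X Y g) := by
          rw [← leftDim, hX]
          simp only [bicategoricalComp, whiskerLeft_smul, Linear.smul_comp, Linear.comp_smul]
    _ = _ := by congr 1; bicategory

end IsPairIso

/-- The cup of `Y` slides down to the cap inside `relProj`, where a snake straightens. -/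
theorem unit_whisker_relProj {r s t : B} (X : r ⟶ s) (Y : r ⟶ t)
    (g : X ≫ dual X ⟶ Y ≫ dual Y) :
    𝟙 X ⊗≫ leftCup Y ▷ X ⊗≫ Y ◁ relProj X Y g = 𝟙 _ ⊗≫ X ◁ (adj X).unit ⊗≫ g ▷ X ⊗≫ 𝟙 _ := by
  have h1 := leftCup_zigzag Y
  unfold relProj
  calc _ = 𝟙 _ ⊗≫ (leftCup Y ▷ (X ≫ 𝟙 s) ≫ (Y ≫ dual Y) ◁ X ◁ (adj X).unit) ⊗≫
            (Y ≫ dual Y) ◁ g ▷ X ⊗≫ Y ◁ leftCap Y ▷ (dual Y ≫ X) ⊗≫ 𝟙 _ := by bicategory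
    _ = 𝟙 _ ⊗≫ X ◁ (adj X).unit ⊗≫ (leftCup Y ▷ ((X ≫ dual X) ≫ X) ≫
            (Y ≫ dual Y) ◁ g ▷ X) ⊗≫ Y ◁ leftCap Y ▷ (dual Y ≫ X) ⊗≫ 𝟙 _ := by
          rw [← whisker_exchange]; bicategory
    _ = 𝟙 _ ⊗≫ X ◁ (adj X).unit ⊗≫ g ▷ X ⊗≫ (leftCup Y ▷ Y ⊗≫ Y ◁ leftCap Y) ▷ (dual Y ≫ X) ⊗≫
            𝟙 _ := by
          rw [← whisker_exchange]; bicategory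
    _ = _ := by rw [h1]; bicategory

theorem whisker_relProj'_counit {r s t : B} (X : r ⟶ s) (Y : r ⟶ t)
    (h : Y ≫ dual Y ⟶ X ≫ dual X) :
    Y ◁ relProj' X Y h ⊗≫ (adj Y).counit ▷ X = 𝟙 _ ⊗≫ h ▷ X ⊗≫ X ◁ leftCap X ⊗≫ 𝟙 _ := by
  have h1 := unit_zigzag Y
  unfold relProj'
  calc _ = 𝟙 _ ⊗≫ Y ◁ (adj Y).unit ▷ (dual Y ≫ X) ⊗≫ (Y ≫ dual Y) ◁ h ▷ X ⊗≫
            ((Y ≫ dual Y) ◁ X ◁ leftCap X ≫ (adj Y).counit ▷ (X ≫ 𝟙 s)) ⊗≫ 𝟙 _ := by bicategory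
    _ = 𝟙 _ ⊗≫ Y ◁ (adj Y).unit ▷ (dual Y ≫ X) ⊗≫ ((Y ≫ dual Y) ◁ h ▷ X ≫
            (adj Y).counit ▷ ((X ≫ dual X) ≫ X)) ⊗≫ X ◁ leftCap X ⊗≫ 𝟙 _ := by
          rw [whisker_exchange]; bicategory
    _ = 𝟙 _ ⊗≫ (Y ◁ (adj Y).unit ⊗≫ (adj Y).counit ▷ Y) ▷ (dual Y ≫ X) ⊗≫ h ▷ X ⊗≫
            X ◁ leftCap X ⊗≫ 𝟙 _ := by
          rw [whisker_exchange]; bicategory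
    _ = _ := by rw [h1]; bicategory

end Projection

/-! ### The relative tensor product is an equivalence -/

section RelativeProduct

variable {B : Type u} [Bicategory.{w, v} B] [DaggerBicategory B] [PivotalBicategory B]

/-- The unnormalised inclusion of the identity into `(Y* ⊗ X) ⊗ (X* ⊗ Y)`. -/
def relCup {r s t : B} (X : r ⟶ s) (Y : r ⟶ t) (h : Y ≫ dual Y ⟶ X ≫ dual X) :
    𝟙 t ⟶ (dual Y ≫ X) ≫ (dual X ≫ Y) :=
  (adj Y).unit ⊗≫ (dual Y ≫ Y) ◁ (adj Y).unit ⊗≫ dual Y ◁ h ▷ Y ⊗≫ 𝟙 _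

/-- The unnormalised projection of `(Y* ⊗ X) ⊗ (X* ⊗ Y)` onto the identity. -/
def relCap {r s t : B} (X : r ⟶ s) (Y : r ⟶ t) (g : X ≫ dual X ⟶ Y ≫ dual Y) :
    (dual Y ≫ X) ≫ (dual X ≫ Y) ⟶ 𝟙 t :=
  𝟙 _ ⊗≫ dual Y ◁ g ▷ Y ⊗≫ (dual Y ≫ Y) ◁ leftCap Y ⊗≫ leftCap Y

theorem dagger_relCap [PivotalDaggerBicategory B] {r s t : B} (X : r ⟶ s) (Y : r ⟶ t)
    (g : X ≫ dual X ⟶ Y ≫ dual Y) : dagger (relCap X Y g) = relCup X Y (dagger g) := by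
  simp only [relCap, relCup, bicategoricalComp, dagger_comp, dagger_whiskerLeft,
    dagger_whiskerRight, dagger_associator, dagger_id, dagger_associator_inv, dagger_rightUnitor,
    Category.assoc, dagger_leftCap, BicategoricalCoherence.iso, Iso.trans_hom,
    whiskerLeftIso_hom, whiskerRightIso_hom, Iso.symm_hom, Iso.refl_hom]

variable [∀ a b : B, Preadditive (a ⟶ b)] [∀ a b : B, Linear ℂ (a ⟶ b)] [LinearDaggerBicategory B]

theorem relProj'_smul {r s t : B} (X : r ⟶ s) (Y : r ⟶ t) (h : Y ≫ dual Y ⟶ X ≫ dual X) (z : ℂ) :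
    relProj' X Y (z • h) = z • relProj' X Y h := by
  simp only [relProj', bicategoricalComp, whiskerLeft_smul, smul_whiskerRight, Linear.smul_comp,
    Linear.comp_smul]

theorem relCup_smul {r s t : B} (X : r ⟶ s) (Y : r ⟶ t) (h : Y ≫ dual Y ⟶ X ≫ dual X) (z : ℂ) :
    relCup X Y (z • h) = z • relCup X Y h := by
  simp only [relCup, bicategoricalComp, whiskerLeft_smul, smul_whiskerRight, Linear.smul_comp,
    Linear.comp_smul]

namespace IsPairIso

variable {r s t : B} {X : r ⟶ s} {Y : r ⟶ t} {c : ℝ} {g : X ≫ dual X ⟶ Y ≫ dual Y}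
  {h : Y ≫ dual Y ⟶ X ≫ dual X}

theorem relCup_comp_relCap (H : IsPairIso X Y c g h) {d : ℂ}
    (hY : leftDim Y = d • 𝟙 (𝟙 t)) : relCup X Y h ≫ relCap X Y g = (d * d) • 𝟙 (𝟙 t) := by
  unfold relCup relCap
  rw [leftDim] at hY
  calc _ = (adj Y).unit ⊗≫ (dual Y ≫ Y) ◁ (adj Y).unit ⊗≫ dual Y ◁ (h ≫ g) ▷ Y ⊗≫
            (dual Y ≫ Y) ◁ leftCap Y ⊗≫ leftCap Y := by bicategory
    _ = (adj Y).unit ⊗≫ (dual Y ≫ Y) ◁ ((adj Y).unit ≫ leftCap Y) ⊗≫ leftCap Y := by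
          rw [H.inv_hom]; bicategory
    _ = d • ((adj Y).unit ≫ leftCap Y) := by
          conv_lhs => rw [hY]
          simp only [bicategoricalComp, whiskerLeft_smul, Linear.smul_comp, Linear.comp_smul]
          congr 1; bicategory
    _ = _ := by rw [hY, smul_smul]

/-- Both factors are a comultiplication with `g` on one leg. After `comul_left` and `comul_right`
(one factor `c` each), the `h` produced by the first meets the `g` of the second and they cancel.
The remaining strings then separate into a cap part followed by a cup part. -/
theorem relProj_whisker_relProj' [PivotalDaggerBicategory B] (H : IsPairIso X Y c g h) :
    relProj X Y g ▷ (dual X ≫ Y) ≫ (dual Y ≫ X) ◁ relProj' Y X g =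
      ((c : ℂ) * (c : ℂ)) • (relCap X Y g ≫ relCup X Y h) := by
  have h1 := H.comul_left
  have h2 := H.comul_right
  rw [dagger_pairMul, dagger_pairMul, dagger_leftCap, dagger_leftCap] at h1 h2
  calc _ = 𝟙 _ ⊗≫ dual Y ◁ ((X ◁ ((λ_ (dual X)).inv ≫ (adj X).unit ▷ dual X ≫
          (α_ (dual X) X (dual X)).hom) ≫ (α_ X (dual X) (X ≫ dual X)).inv) ≫
            g ▷ (X ≫ dual X)) ▷ Y ⊗≫ leftCap Y ▷ (dual Y ≫ (X ≫ dual X) ≫ Y) ⊗≫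
        dual Y ◁ ((X ◁ ((λ_ (dual X)).inv ≫ (adj X).unit ▷ dual X ≫
          (α_ (dual X) X (dual X)).hom) ≫ (α_ X (dual X) (X ≫ dual X)).inv) ≫
            (X ≫ dual X) ◁ g) ▷ Y ⊗≫ (dual Y ≫ X ≫ dual X ≫ Y) ◁ leftCap Y ⊗≫ 𝟙 _ := by
          unfold relProj relProj'; bicategory
    _ = ((c : ℂ) * (c : ℂ)) • (𝟙 _ ⊗≫ dual Y ◁ (g ≫ (Y ◁ ((λ_ (dual Y)).inv ≫
          (adj Y).unit ▷ dual Y ≫ (α_ (dual Y) Y (dual Y)).hom) ≫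
            (α_ Y (dual Y) (Y ≫ dual Y)).inv) ≫ (Y ≫ dual Y) ◁ h) ▷ Y ⊗≫
              leftCap Y ▷ (dual Y ≫ (X ≫ dual X) ≫ Y) ⊗≫
        dual Y ◁ (g ≫ (Y ◁ ((λ_ (dual Y)).inv ≫
          (adj Y).unit ▷ dual Y ≫ (α_ (dual Y) Y (dual Y)).hom) ≫
            (α_ Y (dual Y) (Y ≫ dual Y)).inv) ≫ h ▷ (Y ≫ dual Y)) ▷ Y ⊗≫
              (dual Y ≫ X ≫ dual X ≫ Y) ◁ leftCap Y ⊗≫ 𝟙 _) := by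
          rw [h1, h2]
          simp only [bicategoricalComp, whiskerLeft_smul, smul_whiskerRight, Linear.smul_comp,
            Linear.comp_smul, smul_smul]
    _ = ((c : ℂ) * (c : ℂ)) • (𝟙 _ ⊗≫ dual Y ◁ g ▷ Y ⊗≫
          ((dual Y ≫ Y) ◁ ((adj Y).unit ▷ (dual Y ≫ Y) ⊗≫ dual Y ◁ h ▷ Y) ≫
              leftCap Y ▷ (dual Y ≫ (X ≫ dual X) ≫ Y)) ⊗≫
        dual Y ◁ g ▷ Y ⊗≫ (dual Y ≫ Y) ◁ (adj Y).unit ▷ (dual Y ≫ Y) ⊗≫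
          dual Y ◁ (h ▷ ((Y ≫ dual Y) ≫ Y) ≫
              (X ≫ dual X) ◁ (𝟙 ((Y ≫ dual Y) ≫ Y) ⊗≫ Y ◁ leftCap Y)) ⊗≫ 𝟙 _) := by
          congr 1; bicategory
    _ = ((c : ℂ) * (c : ℂ)) • (𝟙 _ ⊗≫ dual Y ◁ g ▷ Y ⊗≫ leftCap Y ▷ (dual Y ≫ Y) ⊗≫
          (adj Y).unit ▷ (dual Y ≫ Y) ⊗≫ dual Y ◁ (h ≫ g) ▷ Y ⊗≫
          (dual Y ≫ Y) ◁ ((adj Y).unit ▷ (dual Y ≫ Y) ≫ (dual Y ≫ Y) ◁ leftCap Y) ⊗≫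
            dual Y ◁ h ▷ Y ⊗≫ 𝟙 _) := by
          rw [whisker_exchange, ← whisker_exchange h]; congr 1; bicategory
    _ = ((c : ℂ) * (c : ℂ)) • (𝟙 _ ⊗≫ dual Y ◁ g ▷ Y ⊗≫ leftCap Y ▷ (dual Y ≫ Y) ⊗≫
          ((adj Y).unit ▷ (dual Y ≫ Y) ≫ (dual Y ≫ Y) ◁ leftCap Y) ⊗≫
            (dual Y ≫ Y) ◁ (adj Y).unit ⊗≫ dual Y ◁ h ▷ Y ⊗≫ 𝟙 _) := by
          conv_lhs => rw [H.inv_hom, ← whisker_exchange]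
          congr 1; bicategory
    _ = ((c : ℂ) * (c : ℂ)) • (𝟙 _ ⊗≫ dual Y ◁ g ▷ Y ⊗≫
          (leftCap Y ▷ (dual Y ≫ Y) ≫ 𝟙 t ◁ leftCap Y) ⊗≫ (adj Y).unit ⊗≫
            (dual Y ≫ Y) ◁ (adj Y).unit ⊗≫ dual Y ◁ h ▷ Y ⊗≫ 𝟙 _) := by
          conv_lhs => rw [← whisker_exchange]
          congr 1; bicategory
    _ = _ := by
          rw [← whisker_exchange]; unfold relCap relCup; congr 1; bicategory

theorem exists_split [PivotalDaggerBicategory B] (hsplit : HasSplitDaggerIdempotents B)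
    {dX dY : ℝ} (hdX : 0 < dX) (hdY : 0 < dY) (H : IsPairIso X Y (dX / dY) g h)
    (hX : leftDim X = (dX : ℂ) • 𝟙 (𝟙 s)) :
    ∃ (E : t ⟶ s) (i : E ⟶ dual Y ≫ X), IsIsometry i ∧
      dagger i ≫ i = (dX : ℂ)⁻¹ • relProj X Y g ∧ dagger i ≫ i = (dY : ℂ)⁻¹ • relProj' X Y h := by
  have hX0 : (dX : ℂ) ≠ 0 := by exact_mod_cast hdX.ne'
  have hY0 : (dY : ℂ) ≠ 0 := by exact_mod_cast hdY.ne'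
  have hd : dagger ((dX : ℂ)⁻¹ • relProj X Y g) = (dY : ℂ)⁻¹ • relProj' X Y h := by
    rw [dagger_smul, dagger_relProj, H.dagger_eq, relProj'_smul, smul_smul, map_inv₀,
      Complex.conj_ofReal]
    congr 1
    push_cast
    field_simp
  -- The single identity `p p† = p` yields both `p = p†` and `p² = p`.
  have hpp : ((dX : ℂ)⁻¹ • relProj X Y g) ≫ dagger ((dX : ℂ)⁻¹ • relProj X Y g) =
      (dX : ℂ)⁻¹ • relProj X Y g := by
    have h1 := H.relProj_comp_relProj' hX
    rw [hd, Linear.smul_comp, Linear.comp_smul, smul_smul]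
    have h2 : (dX : ℂ)⁻¹ * (dY : ℂ)⁻¹ = (dX : ℂ)⁻¹ * (dX : ℂ)⁻¹ * ((dX / dY : ℝ) : ℂ) := by
      push_cast
      field_simp
    rw [h2, mul_smul, h1, smul_smul, inv_mul_cancel_right₀ hX0]
  have hp : dagger ((dX : ℂ)⁻¹ • relProj X Y g) = (dX : ℂ)⁻¹ • relProj X Y g := by
    conv_lhs => rw [← hpp]
    rw [dagger_comp, dagger_dagger, hpp]
  obtain ⟨E, i, hi, hi'⟩ := hsplit _ _ hp (by rw [hp] at hpp; exact hpp)
  exact ⟨E, i, hi, hi', by rw [hi', ← hp, hd]⟩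

/-- `i ⊗ i'` is an isometry whose range projection is also that of a coisometry onto `𝟙 t`, so the
composite of the two is unitary. The first projection is written with `relProj` and the second with
`relProj'`, so that the same `g` occurs in both. -/
theorem exists_unitary_to_id [PivotalDaggerBicategory B]
    {dX dY : ℝ} (hdX : 0 < dX) (hdY : 0 < dY) (H : IsPairIso X Y (dX / dY) g h)
    (hY : leftDim Y = (dY : ℂ) • 𝟙 (𝟙 t)) {E : t ⟶ s} {E' : s ⟶ t} {i : E ⟶ dual Y ≫ X}
    {i' : E' ⟶ dual X ≫ Y} (hi : IsIsometry i) (hi' : IsIsometry i')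
    (hp : dagger i ≫ i = (dX : ℂ)⁻¹ • relProj X Y g)
    (hq : dagger i' ≫ i' = (dX : ℂ)⁻¹ • relProj' Y X g) :
    ∃ e : E ≫ E' ⟶ 𝟙 t, IsUnitary e := by
  have hX0 : (dX : ℂ) ≠ 0 := by exact_mod_cast hdX.ne'
  have hY0 : (dY : ℂ) ≠ 0 := by exact_mod_cast hdY.ne'
  -- Chosen so that `k² (dX / dY) dY² = 1`, the condition for `W` to be a coisometry.
  set k : ℝ := (Real.sqrt (dX * dY))⁻¹ with hk
  have hkk : (k : ℂ) * (k : ℂ) = ((dX * dY : ℝ) : ℂ)⁻¹ := by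
    rw [hk, ← Complex.ofReal_mul, ← mul_inv, Real.mul_self_sqrt (by positivity)]
    push_cast; rfl
  set W := (k : ℂ) • relCap X Y g with hW
  have hdW : dagger W = ((k : ℂ) * ((dX / dY : ℝ) : ℂ)) • relCup X Y h := by
    rw [hW, dagger_smul, dagger_relCap, H.dagger_eq, relCup_smul, smul_smul, Complex.conj_ofReal]
  have hWW : dagger W ≫ W = 𝟙 _ := by
    rw [hdW, hW, Linear.smul_comp, Linear.comp_smul, H.relCup_comp_relCap hY, smul_smul, smul_smul]
    have : (k : ℂ) * ((dX / dY : ℝ) : ℂ) * ((k : ℂ) * ((dY : ℂ) * (dY : ℂ))) = 1 := by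
      rw [show (k : ℂ) * ((dX / dY : ℝ) : ℂ) * ((k : ℂ) * ((dY : ℂ) * (dY : ℂ))) =
        ((k : ℂ) * (k : ℂ)) * (((dX / dY : ℝ) : ℂ) * (dY : ℂ) * (dY : ℂ)) by ring, hkk]
      push_cast
      field_simp
    rw [← mul_assoc] at this
    rw [this, one_smul]
  have hPQ : (dagger i ≫ i) ▷ (dual X ≫ Y) ≫ (dual Y ≫ X) ◁ (dagger i' ≫ i') = W ≫ dagger W := by
    rw [hp, hq, hdW, hW, smul_whiskerRight, whiskerLeft_smul, Linear.smul_comp, Linear.comp_smul,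
      H.relProj_whisker_relProj', Linear.smul_comp, Linear.comp_smul, smul_smul, smul_smul,
      smul_smul]
    congr 1
    rw [← mul_assoc (k : ℂ), hkk]
    push_cast
    field_simp
  unfold IsIsometry at hi hi'
  set J : E ≫ E' ⟶ (dual Y ≫ X) ≫ (dual X ≫ Y) := i ▷ E' ≫ (dual Y ≫ X) ◁ i' with hJ
  have hJJ : J ≫ dagger J = 𝟙 _ := by
    rw [hJ, dagger_comp, dagger_whiskerLeft, dagger_whiskerRight, Category.assoc,
      ← Bicategory.whiskerLeft_comp_assoc, hi', Bicategory.whiskerLeft_id, Category.id_comp,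
      ← Bicategory.comp_whiskerRight, hi, Bicategory.id_whiskerRight]
  have hJJ' : dagger J ≫ J = W ≫ dagger W := by
    rw [← hPQ, hJ, dagger_comp, dagger_whiskerLeft, dagger_whiskerRight, Category.assoc,
      ← Bicategory.comp_whiskerRight_assoc, whisker_exchange_assoc, ← Bicategory.whiskerLeft_comp]
  refine ⟨J ≫ W, ?_, ?_⟩
  · rw [IsIsometry, dagger_comp, Category.assoc, ← Category.assoc W, ← hJJ']
    simp only [Category.assoc]
    rw [hJJ, Category.comp_id, hJJ]
  · rw [dagger_comp, Category.assoc, ← Category.assoc _ J, hJJ', Category.assoc, hWW,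
      Category.comp_id, hWW]

theorem exists_unitary_comp [PivotalDaggerBicategory B]
    {dX dY : ℝ} (hdX : 0 < dX) (hdY : 0 < dY) (H : IsPairIso X Y (dX / dY) g h)
    {E : t ⟶ s} {i : E ⟶ dual Y ≫ X} (hi : IsIsometry i)
    (hp : dagger i ≫ i = (dX : ℂ)⁻¹ • relProj X Y g)
    (hp' : dagger i ≫ i = (dY : ℂ)⁻¹ • relProj' X Y h) :
    ∃ τ : X ⟶ Y ≫ E, IsUnitary τ := by
  have hX0 : (dX : ℂ) ≠ 0 := by exact_mod_cast hdX.ne'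
  have hY0 : (dY : ℂ) ≠ 0 := by exact_mod_cast hdY.ne'
  unfold IsIsometry at hi
  set M : X ⟶ Y ≫ dual Y ≫ X := (λ_ X).inv ≫ leftCup Y ▷ X ≫ (α_ _ _ _).hom with hM
  have hdM : dagger M = (α_ _ _ _).inv ≫ (adj Y).counit ▷ X ≫ (λ_ X).hom := by
    simp only [hM, dagger_comp, dagger_whiskerRight, dagger_leftCup, dagger_associator,
      dagger_leftUnitor_inv, Category.assoc]
  set D : X ⟶ (X ≫ dual X) ≫ X := (ρ_ X).inv ≫ X ◁ (adj X).unit ≫ (α_ _ _ _).inv with hD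
  set D' : (X ≫ dual X) ≫ X ⟶ X := (α_ _ _ _).hom ≫ X ◁ leftCap X ≫ (ρ_ X).hom with hD'
  clear_value M D D'
  have h1 : M ≫ Y ◁ relProj X Y g = D ≫ g ▷ X ≫ (α_ _ _ _).hom := by
    have := unit_whisker_relProj X Y g
    calc _ = 𝟙 X ⊗≫ leftCup Y ▷ X ⊗≫ Y ◁ relProj X Y g := by rw [hM]; bicategory
      _ = _ := by rw [this, hD]; bicategory
  have h2 : Y ◁ relProj' X Y h ≫ dagger M = (α_ _ _ _).inv ≫ h ▷ X ≫ D' := by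
    have := whisker_relProj'_counit X Y h
    calc _ = (Y ◁ relProj' X Y h ⊗≫ (adj Y).counit ▷ X) ≫ (λ_ X).hom := by rw [hdM]; bicategory
      _ = _ := by rw [this, hD']; bicategory
  -- `D' ≫ D` is cap-then-cup on `X`; conjugating it by `g` gives `relProj`.
  have h3 : (α_ _ _ _).inv ≫ h ▷ X ≫ D' ≫ D ≫ g ▷ X ≫ (α_ _ _ _).hom = Y ◁ relProj X Y g := by
    have := whisker_relProj X Y g H.map_mul
    calc _ = (α_ _ _ _).inv ≫ h ▷ X ≫
          (𝟙 _ ⊗≫ X ◁ (leftCap X ≫ (adj X).unit) ⊗≫ g ▷ X ⊗≫ 𝟙 _) := by rw [hD, hD']; bicategory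
      _ = (α_ _ _ _).inv ≫ (h ≫ g) ▷ X ⊗≫ Y ◁ relProj X Y g := by rw [← this]; bicategory
      _ = _ := by rw [H.inv_hom]; bicategory
  have h4 : D ≫ g ▷ X ≫ (α_ _ _ _).hom ≫ dagger M = ((dX / dY : ℝ) : ℂ) • 𝟙 X := by
    have := unit_zigzag X
    calc _ = (ρ_ X).inv ≫ X ◁ (adj X).unit ≫ (α_ _ _ _).inv ≫ (g ≫ (adj Y).counit) ▷ X ≫
          (λ_ X).hom := by rw [hdM, hD]; bicategory
      _ = ((dX / dY : ℝ) : ℂ) • ((ρ_ X).inv ≫ X ◁ (adj X).unit ≫ (α_ _ _ _).inv ≫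
          (adj X).counit ▷ X ≫ (λ_ X).hom) := by
          rw [H.comp_counit]
          simp only [smul_whiskerRight, Linear.smul_comp, Linear.comp_smul]
      _ = ((dX / dY : ℝ) : ℂ) • ((ρ_ X).inv ≫ (X ◁ (adj X).unit ⊗≫ (adj X).counit ▷ X) ≫
          (λ_ X).hom) := by congr 1; bicategory
      _ = _ := by rw [this]; simp
  have hkk : ((Real.sqrt dY : ℝ) : ℂ) * ((Real.sqrt dY : ℝ) : ℂ) = dY := by
    rw [← Complex.ofReal_mul, Real.mul_self_sqrt hdY.le]
  -- The factor `√dY` compensates the scalar `dX⁻¹ (dX / dY) = dY⁻¹` that arises in `h5` and `h6`.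
  refine ⟨((Real.sqrt dY : ℝ) : ℂ) • (M ≫ Y ◁ dagger i), ?_, ?_⟩
  · have h5 : (M ≫ Y ◁ dagger i) ≫ dagger (M ≫ Y ◁ dagger i) = (dY : ℂ)⁻¹ • 𝟙 X := by
      rw [dagger_comp, dagger_whiskerLeft, dagger_dagger, Category.assoc,
        ← Bicategory.whiskerLeft_comp_assoc, hp, whiskerLeft_smul, Linear.smul_comp,
        Linear.comp_smul, ← Category.assoc, h1, Category.assoc, Category.assoc, h4, smul_smul]
      congr 1
      push_cast
      field_simp
    rw [IsIsometry, dagger_smul, Complex.conj_ofReal, Linear.smul_comp, Linear.comp_smul, h5,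
      smul_smul, smul_smul, hkk, mul_inv_cancel₀ hY0, one_smul]
  · have h6 : Y ◁ (dagger i ≫ i) ≫ dagger M ≫ M ≫ Y ◁ (dagger i ≫ i) =
        (dY : ℂ)⁻¹ • Y ◁ (dagger i ≫ i) := by
      -- The outer copy of the projection takes the form `relProj'` and the inner one `relProj`, to
      -- match `h2` and `h1`.
      conv_lhs => lhs; rw [hp']
      conv_lhs => rw [hp]
      conv_rhs => rw [hp]
      rw [whiskerLeft_smul, whiskerLeft_smul, Linear.smul_comp, Linear.comp_smul, Linear.comp_smul,
        Linear.comp_smul, h1, ← Category.assoc, h2, Category.assoc, Category.assoc, h3]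
    have h7 : dagger (M ≫ Y ◁ dagger i) ≫ (M ≫ Y ◁ dagger i) = (dY : ℂ)⁻¹ • 𝟙 (Y ≫ E) := by
      rw [dagger_comp, dagger_whiskerLeft, dagger_dagger]
      have hii : Y ◁ i ≫ Y ◁ dagger i = 𝟙 _ := by
        rw [← Bicategory.whiskerLeft_comp, hi, Bicategory.whiskerLeft_id]
      calc (Y ◁ i ≫ dagger M) ≫ M ≫ Y ◁ dagger i = (Y ◁ i ≫ Y ◁ dagger i) ≫
            (Y ◁ i ≫ dagger M ≫ M ≫ Y ◁ dagger i) ≫ Y ◁ i ≫ Y ◁ dagger i := by rw [hii]; simp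
        _ = Y ◁ i ≫ (Y ◁ (dagger i ≫ i) ≫ dagger M ≫ M ≫ Y ◁ (dagger i ≫ i)) ≫ Y ◁ dagger i := by
            simp only [Bicategory.whiskerLeft_comp, Category.assoc]
        _ = _ := by
            rw [h6, Linear.smul_comp, Linear.comp_smul, Bicategory.whiskerLeft_comp, Category.assoc,
              hii, Category.comp_id, hii]
    rw [dagger_smul, Complex.conj_ofReal, Linear.smul_comp, Linear.comp_smul, h7,
      smul_smul, smul_smul, hkk, mul_inv_cancel₀ hY0, one_smul]

theorem areEquivalent [PivotalDaggerBicategory B] (hsplit : HasSplitDaggerIdempotents B)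
    {dX dY : ℝ} (hdX : 0 < dX) (hdY : 0 < dY) (H : IsPairIso X Y (dX / dY) g h)
    (hX : leftDim X = (dX : ℂ) • 𝟙 (𝟙 s)) (hY : leftDim Y = (dY : ℂ) • 𝟙 (𝟙 t)) :
    AreEquivalent X Y := by
  have H' : IsPairIso Y X (dY / dX) h g := by simpa using H.symm
  obtain ⟨E, i, hi, hp, hp'⟩ := H.exists_split hsplit hdX hdY hX
  obtain ⟨E', i', hi', hq, hq'⟩ := H'.exists_split hsplit hdY hdX hY
  obtain ⟨e, he⟩ := H.exists_unitary_to_id hdX hdY hY hi hi' hp hq'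
  obtain ⟨η, hη⟩ := H'.exists_unitary_to_id hdY hdX hX hi' hi hq hp'
  exact ⟨E, ⟨E', dagger η, e, ⟨by rw [IsIsometry, dagger_dagger]; exact hη.2,
    by rw [dagger_dagger]; exact hη.1⟩, he⟩, H.exists_unitary_comp hdX hdY hi hp hp'⟩

end IsPairIso

end RelativeProduct

/-! ### Mates slide along cups and caps -/

section Mates

variable {B : Type u} [Bicategory.{w, v} B] {a b : B} {r₁ r₂ : a ⟶ b} {l₁ l₂ : b ⟶ a}
  (adj₁ : Bicategory.Adjunction l₁ r₁) (adj₂ : Bicategory.Adjunction l₂ r₂)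

theorem unit_conjugateEquiv_symm (x : r₁ ⟶ r₂) :
    adj₂.unit ≫ (conjugateEquiv adj₁ adj₂).symm x ▷ r₂ = adj₁.unit ≫ l₁ ◁ x := by
  have h := adj₂.right_triangle
  unfold rightZigzag at h
  rw [conjugateEquiv_symm_apply']
  calc _ = 𝟙 _ ⊗≫ (𝟙 b ◁ adj₂.unit ≫ adj₁.unit ▷ (l₂ ≫ r₂)) ⊗≫ l₁ ◁ x ▷ (l₂ ≫ r₂) ⊗≫
            l₁ ◁ adj₂.counit ▷ r₂ ⊗≫ 𝟙 _ := by bicategory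
    _ = 𝟙 _ ⊗≫ adj₁.unit ⊗≫ l₁ ◁ (r₁ ◁ adj₂.unit ≫ x ▷ (l₂ ≫ r₂)) ⊗≫
            l₁ ◁ adj₂.counit ▷ r₂ ⊗≫ 𝟙 _ := by rw [whisker_exchange]; bicategory
    _ = 𝟙 _ ⊗≫ adj₁.unit ⊗≫ l₁ ◁ x ⊗≫ l₁ ◁ (r₂ ◁ adj₂.unit ⊗≫ adj₂.counit ▷ r₂) ⊗≫ 𝟙 _ := by
          rw [whisker_exchange]; bicategory
    _ = _ := by rw [h]; bicategory

theorem conjugateEquiv_symm_counit (x : r₁ ⟶ r₂) :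
    r₁ ◁ (conjugateEquiv adj₁ adj₂).symm x ≫ adj₁.counit = x ▷ l₂ ≫ adj₂.counit := by
  have h := adj₁.right_triangle
  unfold rightZigzag at h
  rw [conjugateEquiv_symm_apply']
  calc _ = 𝟙 _ ⊗≫ r₁ ◁ adj₁.unit ▷ l₂ ⊗≫ (r₁ ≫ l₁) ◁ x ▷ l₂ ⊗≫
            ((r₁ ≫ l₁) ◁ adj₂.counit ≫ adj₁.counit ▷ 𝟙 a) ⊗≫ 𝟙 _ := by bicategory
    _ = 𝟙 _ ⊗≫ r₁ ◁ adj₁.unit ▷ l₂ ⊗≫ ((r₁ ≫ l₁) ◁ x ≫ adj₁.counit ▷ r₂) ▷ l₂ ⊗≫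
            adj₂.counit ⊗≫ 𝟙 _ := by rw [whisker_exchange]; bicategory
    _ = 𝟙 _ ⊗≫ (r₁ ◁ adj₁.unit ⊗≫ adj₁.counit ▷ r₁) ▷ l₂ ⊗≫ x ▷ l₂ ⊗≫ adj₂.counit ⊗≫ 𝟙 _ := by
          rw [whisker_exchange]; bicategory
    _ = _ := by rw [h]; bicategory

/-- The snake equation recovers a 2-morphism between duals from its pairing with the cap. -/
theorem eq_of_whisker_counit_eq {x y : l₂ ⟶ l₁}
    (h : r₁ ◁ x ≫ adj₁.counit = r₁ ◁ y ≫ adj₁.counit) : x = y := by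
  have key : ∀ z : l₂ ⟶ l₁, z = 𝟙 _ ⊗≫ adj₁.unit ▷ l₂ ⊗≫ l₁ ◁ (r₁ ◁ z ≫ adj₁.counit) ⊗≫ 𝟙 _ := by
    intro z
    have h := adj₁.left_triangle
    unfold leftZigzag at h
    symm
    calc _ = 𝟙 _ ⊗≫ (adj₁.unit ▷ l₂ ≫ (l₁ ≫ r₁) ◁ z) ⊗≫ l₁ ◁ adj₁.counit ⊗≫ 𝟙 _ := by bicategory
      _ = 𝟙 _ ⊗≫ z ⊗≫ (adj₁.unit ▷ l₁ ⊗≫ l₁ ◁ adj₁.counit) ⊗≫ 𝟙 _ := by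
          rw [← whisker_exchange]; bicategory
      _ = _ := by rw [h]; bicategory
  rw [key x, key y, h]

end Mates

/-! ### Compatibility of duals with the dagger -/

section Dual

variable {B : Type u} [Bicategory.{w, v} B]

theorem relate_comp_relate {a b : B} {X : a ⟶ b} {L₁ L₂ : b ⟶ a}
    (adj₁ : Bicategory.Adjunction L₁ X) (adj₂ : Bicategory.Adjunction L₂ X) :
    relate adj₁ adj₂ ≫ relate adj₂ adj₁ = 𝟙 L₁ := by
  simp [relate]

variable [DaggerBicategory B] [PivotalBicategory B]

/-- Naturality of the pivot: the right transpose also slides along the left cup, so left and right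
transposes agree. -/
theorem leftCup_transpose {a b : B} {X Y : a ⟶ b} (f : X ⟶ Y) :
    leftCup X ≫ f ▷ dual X = leftCup Y ≫ Y ◁ transpose f := by
  have h := unit_conjugateEquiv_symm (adj (dual Y)) (adj (dual X)) (transpose f)
  calc _ = (adj (dual X)).unit ≫ ((pivot X).hom ≫ f) ▷ dual X := by
        simp only [leftCup, Category.assoc, Bicategory.comp_whiskerRight]
    _ = ((adj (dual X)).unit ≫ transpose (transpose f) ▷ dual X) ≫ (pivot Y).hom ▷ dual X := by
        rw [← pivot_naturality]; simp only [Category.assoc, Bicategory.comp_whiskerRight]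
    _ = _ := by
        unfold transpose at h ⊢
        rw [h]
        simp only [leftCup, Category.assoc, whisker_exchange]

/-- Compatibility of the pivot with composition: the left cup of a composite is the nested left
cups, up to the canonical identification of duals. -/
theorem leftCup_comp {a b c : B} (X : a ⟶ b) (Y : b ⟶ c) :
    leftCup (X ≫ Y) ≫ (X ≫ Y) ◁ relate (adj (X ≫ Y)) ((adj Y).comp (adj X)) =
      leftCup X ⊗≫ X ◁ leftCup Y ▷ dual X ⊗≫ 𝟙 _ := by
  have h1 := unit_conjugateEquiv_symm (adj (dual (X ≫ Y))) (adj (dual Y ≫ dual X))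
    (relate (adj (X ≫ Y)) ((adj Y).comp (adj X)))
  have h2 := unit_conjugateEquiv_symm (adj (dual Y ≫ dual X)) ((adj (dual X)).comp (adj (dual Y)))
    (𝟙 _)
  have h3 := pivot_comp X Y
  rw [Bicategory.whiskerLeft_id, Category.comp_id] at h2
  calc _ = ((adj (dual (X ≫ Y))).unit ≫ dual (dual (X ≫ Y)) ◁
            relate (adj (X ≫ Y)) ((adj Y).comp (adj X))) ≫
              (pivot (X ≫ Y)).hom ▷ (dual Y ≫ dual X) := by
          simp only [leftCup, Category.assoc, whisker_exchange]
    _ = ((adj (dual X)).comp (adj (dual Y))).unit ≫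
          (doubleDualMul X Y ≫ (pivot (X ≫ Y)).hom) ▷ (dual Y ≫ dual X) := by
          rw [← h1, ← h2]
          simp only [doubleDualMul, relate, transpose, Category.assoc,
            Bicategory.comp_whiskerRight]
    _ = _ := by
          rw [h3]
          simp only [Bicategory.Adjunction.comp_unit, Bicategory.Adjunction.compUnit, leftCup]
          calc _ = (adj (dual X)).unit ⊗≫ (dual (dual X) ◁ (adj (dual Y)).unit ≫
                  (pivot X).hom ▷ (dual (dual Y) ≫ dual Y)) ▷ dual X ⊗≫
                    X ◁ (pivot Y).hom ▷ dual Y ▷ dual X ⊗≫ 𝟙 _ := by bicategory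
            _ = _ := by rw [whisker_exchange]; bicategory

/-- The pairing of `leftCup` with an arbitrary right dual of `Z` is the dagger of its counit. -/
def IsDaggerDual {a b : B} {Z : a ⟶ b} {L : b ⟶ a} (A : Bicategory.Adjunction L Z) : Prop :=
  leftCup Z ≫ Z ◁ relate (adj Z) A = dagger A.counit

variable [PivotalDaggerBicategory B]

theorem isDaggerDual_comp {a b c : B} (X : a ⟶ b) (Y : b ⟶ c) :
    IsDaggerDual ((adj Y).comp (adj X)) := by
  rw [IsDaggerDual, leftCup_comp]
  simp only [Bicategory.Adjunction.comp_counit, Bicategory.Adjunction.compCounit,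
    bicategoricalComp, dagger_comp, dagger_whiskerLeft,
    dagger_whiskerRight, dagger_associator, dagger_id, dagger_associator_inv, dagger_leftUnitor,
    Category.assoc, dagger_counit, BicategoricalCoherence.iso, Iso.trans_hom,
    whiskerLeftIso_hom, whiskerRightIso_hom, Iso.symm_hom, Iso.refl_hom]

/-- The mate of a unitary with respect to dagger duals is unitary. -/
theorem IsDaggerDual.isUnitary_mate {a b : B} {X Z : a ⟶ b} {L : b ⟶ a}
    {A : Bicategory.Adjunction L Z} (hA : IsDaggerDual A) {τ : X ⟶ Z} (hτ : IsUnitary τ) :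
    IsUnitary ((conjugateEquiv A (adj X)).symm (dagger τ)) := by
  -- The dagger of the mate of `τ†` is the mate of `τ`; the two agree because they pair equally with
  -- the cap. Unitarity then follows from functoriality of mates.
  have h1 : dagger ((conjugateEquiv A (adj X)).symm (dagger τ)) =
      (conjugateEquiv (adj X) A).symm τ := by
    have h2 : (conjugateEquiv (adj X) A).symm τ = relate A (adj Z) ≫ transpose τ := by
      simp [relate, transpose]
    have h3 := conjugateEquiv_symm_counit A (adj X) (dagger τ)
    have h4 : dagger A.counit ≫ Z ◁ (conjugateEquiv (adj X) A).symm τ =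
        leftCup X ≫ τ ▷ dual X := by
      rw [h2, ← hA, Bicategory.whiskerLeft_comp, Category.assoc, leftCup_transpose,
        ← Bicategory.whiskerLeft_comp_assoc, relate_comp_relate, Bicategory.whiskerLeft_id,
        Category.id_comp]
    have h5 := congrArg dagger h4
    rw [dagger_comp, dagger_comp, dagger_dagger, dagger_whiskerLeft, dagger_whiskerRight,
      dagger_leftCup, ← h3] at h5
    rw [← eq_of_whisker_counit_eq A h5, dagger_dagger]
  refine ⟨?_, ?_⟩
  · rw [IsIsometry, h1]
    exact Bicategory.conjugateEquiv_symm_comm _ _ hτ.1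
  · rw [h1]
    exact Bicategory.conjugateEquiv_symm_comm _ _ hτ.2

end Dual

/-! ### Unitary homomorphisms preserve stars -/

section Star

variable {B : Type u} [Bicategory.{w, v} B] [DaggerBicategory B] {r : B}

/-- A unitary homomorphism of Frobenius monoids is automatically compatible with the stars. -/
theorem isStarHom_of_isUnitary {A A' : FrobeniusMonoid r} {f : A.obj ⟶ A'.obj} (hf : IsUnitary f)
    (hm : A.mul ≫ f = f ▷ A.obj ≫ A'.obj ◁ f ≫ A'.mul) (h1 : A.one ≫ f = A'.one) :
    IsStarHom A A' f where
  map_mul := hm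
  map_one := h1
  map_star := by
    have h2 : f ≫ dagger A'.one = dagger A.one := by
      rw [← h1, dagger_comp, ← Category.assoc, hf.1, Category.id_comp]
    have h3 : dagger A.mul ≫ A.obj ◁ dagger A.one = (ρ_ A.obj).inv := by
      rw [← dagger_whiskerLeft, ← dagger_comp, A.mul_one, dagger_rightUnitor]
    -- Bending `f` with the Frobenius cup and cap gives a right inverse in composition order:
    -- multiplicativity moves `f` past the product, and the Frobenius and unit laws collapse the
    -- rest. As `f` is invertible, that inverse is `f†`.
    have h4 : f ≫ (λ_ A'.obj).inv ≫ (A.one ≫ dagger A.mul) ▷ A'.obj ≫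
        (α_ A.obj A.obj A'.obj).hom ≫ A.obj ◁ (f ▷ A'.obj ≫ A'.mul ≫ dagger A'.one) ≫
          (ρ_ A.obj).hom = 𝟙 _ := by
      calc _ = 𝟙 _ ⊗≫ (𝟙 r ◁ f ≫ (A.one ≫ dagger A.mul) ▷ A'.obj) ⊗≫
            A.obj ◁ (f ▷ A'.obj ≫ A'.mul ≫ dagger A'.one) ⊗≫ 𝟙 _ := by bicategory
        _ = 𝟙 _ ⊗≫ (A.one ≫ dagger A.mul) ▷ A.obj ⊗≫
            A.obj ◁ ((A.obj ◁ f ≫ f ▷ A'.obj) ≫ A'.mul ≫ dagger A'.one) ⊗≫ 𝟙 _ := by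
            rw [whisker_exchange]; bicategory
        _ = 𝟙 _ ⊗≫ A.one ▷ A.obj ≫ (dagger A.mul ▷ A.obj ≫ (α_ A.obj A.obj A.obj).hom ≫
            A.obj ◁ A.mul) ⊗≫ A.obj ◁ (f ≫ dagger A'.one) ⊗≫ 𝟙 _ := by
            rw [whisker_exchange]
            have : (f ▷ A.obj ≫ A'.obj ◁ f) ≫ A'.mul ≫ dagger A'.one =
                A.mul ≫ f ≫ dagger A'.one := by
              rw [← Category.assoc A.mul, hm]; simp only [Category.assoc]
            rw [this]; bicategory
        _ = 𝟙 _ ⊗≫ (A.one ▷ A.obj ≫ A.mul) ⊗≫ (dagger A.mul ≫ A.obj ◁ dagger A.one) ⊗≫ 𝟙 _ := by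
            rw [A.frobenius_right, h2]; bicategory
        _ = _ := by rw [A.one_mul, h3]; bicategory
    rw [← Category.comp_id (dagger f), ← h4, ← Category.assoc, hf.2, Category.id_comp]

end Star

/-! ### Scalar endomorphisms and cups and caps of invertible 1-morphisms -/

section Invertible

variable {B : Type u} [Bicategory.{w, v} B]

/-- Tensoring with an invertible 1-morphism loses nothing: `E'` undoes `E`. -/
theorem eq_conj_whiskerRight {a b c : B} {W W' : a ⟶ b} {E : b ⟶ c} {E' : c ⟶ b}
    (e : E ≫ E' ≅ 𝟙 b) (f : W ⟶ W') : f = (ρ_ W).inv ≫ W ◁ e.inv ≫ (α_ W E E').inv ≫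
      (f ▷ E) ▷ E' ≫ (α_ W' E E').hom ≫ W' ◁ e.hom ≫ (ρ_ W').hom := by
  symm
  calc _ = 𝟙 _ ⊗≫ W ◁ e.inv ⊗≫ (f ▷ (E ≫ E') ≫ W' ◁ e.hom) ⊗≫ 𝟙 _ := by bicategory
    _ = 𝟙 _ ⊗≫ W ◁ (e.inv ≫ e.hom) ⊗≫ f ⊗≫ 𝟙 _ := by rw [← whisker_exchange]; bicategory
    _ = _ := by rw [Iso.inv_hom_id]; bicategory

theorem whiskerRight_injective {a b c : B} {W W' : a ⟶ b} {E : b ⟶ c} {E' : c ⟶ b}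
    (e : E ≫ E' ≅ 𝟙 b) {f g : W ⟶ W'} (h : f ▷ E = g ▷ E) : f = g := by
  rw [eq_conj_whiskerRight e f, eq_conj_whiskerRight e g, h]

variable [∀ a b : B, Preadditive (a ⟶ b)] [∀ a b : B, Linear ℂ (a ⟶ b)]

/-- Every endomorphism of `W` is a scalar. -/
def HasScalarEnd {a b : B} (W : a ⟶ b) : Prop := ∀ g : W ⟶ W, ∃ z : ℂ, g = z • 𝟙 W

theorem IsSimpleObj.id_ne_zero {s : B} (hs : IsSimpleObj s) : 𝟙 (𝟙 s) ≠ 0 := by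
  intro h
  obtain ⟨e⟩ := hs
  have : e.symm 1 = 0 := by rw [← Category.id_comp (e.symm 1), h, Limits.zero_comp]
  simp at this

theorem IsSimpleObj.hasScalarEnd {s : B} (hs : IsSimpleObj s) : HasScalarEnd (𝟙 s) := by
  intro g
  have h0 := hs.id_ne_zero
  obtain ⟨e⟩ := hs
  have h1 : e (𝟙 (𝟙 s)) ≠ 0 := by simpa using h0
  refine ⟨e g / e (𝟙 _), e.injective ?_⟩
  rw [map_smul, smul_eq_mul, div_mul_cancel₀ _ h1]

theorem HasScalarEnd.of_iso {a b : B} {V W : a ⟶ b} (hV : HasScalarEnd V) (i : V ≅ W) :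
    HasScalarEnd W := by
  intro g
  obtain ⟨z, hz⟩ := hV (i.hom ≫ g ≫ i.inv)
  refine ⟨z, ?_⟩
  calc g = i.inv ≫ (i.hom ≫ g ≫ i.inv) ≫ i.hom := by simp
    _ = _ := by rw [hz]; simp

variable [DaggerBicategory B] [LinearDaggerBicategory B]

theorem HasScalarEnd.comp {a b c : B} {W : a ⟶ b} (hW : HasScalarEnd W) {E : b ⟶ c} {E' : c ⟶ b}
    (e : E ≫ E' ≅ 𝟙 b) (e' : E' ≫ E ≅ 𝟙 c) : HasScalarEnd (W ≫ E) := by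
  intro g
  let i : W ≅ (W ≫ E) ≫ E' := (ρ_ W).symm ≪≫ whiskerLeftIso W e.symm ≪≫ (α_ W E E').symm
  obtain ⟨z, hz⟩ := hW.of_iso i (g ▷ E')
  refine ⟨z, whiskerRight_injective e' ?_⟩
  rw [hz, smul_whiskerRight, Bicategory.id_whiskerRight]

/-- Taking mates is a bijection between endomorphisms of the two adjoints and respects scalars and
identities. -/
theorem HasScalarEnd.of_adjunction {a b : B} {l : a ⟶ b} {r : b ⟶ a} (hr : HasScalarEnd r)
    (A : Bicategory.Adjunction l r) : HasScalarEnd l := by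
  intro g
  obtain ⟨z, hz⟩ := hr (Bicategory.conjugateEquiv A A g)
  refine ⟨z, (Bicategory.conjugateEquiv A A).injective ?_⟩
  have h1 := Bicategory.conjugateEquiv_id A
  rw [hz, ← h1]
  simp only [Bicategory.conjugateEquiv_apply', whiskerLeft_smul, smul_whiskerRight,
    Linear.smul_comp, Linear.comp_smul]

variable [PivotalBicategory B]

theorem comp_unit_eq_smul {s t : B} (hs : IsSimpleObj s) (ht : IsSimpleObj t) {E : t ⟶ s}
    {E' : s ⟶ t} (e : E ≫ E' ≅ 𝟙 t) (e' : E' ≫ E ≅ 𝟙 s) {a : ℂ} (ha : a ≠ 0)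
    (hE : leftDim E = a • 𝟙 (𝟙 s)) : leftCap E ≫ (adj E).unit = a • 𝟙 (dual E ≫ E) := by
  have hE1 : HasScalarEnd E := (ht.hasScalarEnd.comp e e').of_iso (λ_ E)
  -- Scalar endomorphisms pass from `𝟙 t` to `E`, to `E*`, and to `E* ⊗ E`. Precomposing with the
  -- cup, nonzero because `a ≠ 0`, forces `z = a`.
  obtain ⟨z, hz⟩ := ((hE1.of_adjunction (adj E)).comp e e') (leftCap E ≫ (adj E).unit)
  have h1 : a • (adj E).unit = z • (adj E).unit := by
    calc _ = ((adj E).unit ≫ leftCap E) ≫ (adj E).unit := by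
          rw [← leftDim, hE]; simp
      _ = _ := by rw [Category.assoc, hz]; simp
  have h2 : (a - z) • (adj E).unit = 0 := by rw [sub_smul, h1, sub_self]
  rcases smul_eq_zero.1 h2 with h3 | h3
  · rw [hz, sub_eq_zero.1 h3]
  · rw [leftDim, h3, Limits.zero_comp] at hE
    rcases smul_eq_zero.1 hE.symm with h4 | h4
    · exact absurd h4 ha
    · exact absurd h4 hs.id_ne_zero

variable [PivotalDaggerBicategory B]

/-- Relations between cups and caps of an invertible 1-morphism of left dimension `a`. -/
structure IsInvertibleDual {s t : B} (E : t ⟶ s) (a : ℝ) : Prop where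
  whisker_leftCap : E ◁ leftCap E ≫ (ρ_ E).hom =
    (a : ℂ) • ((α_ E (dual E) E).inv ≫ (adj E).counit ▷ E ≫ (λ_ E).hom)
  counit_leftCup : (adj E).counit ≫ leftCup E = (a : ℂ)⁻¹ • 𝟙 (E ≫ dual E)
  leftCup_counit : leftCup E ≫ (adj E).counit = (a : ℂ)⁻¹ • 𝟙 (𝟙 t)

theorem isInvertibleDual {s t : B} (hs : IsSimpleObj s) (ht : IsSimpleObj t) {E : t ⟶ s}
    {E' : s ⟶ t} (e : E ≫ E' ≅ 𝟙 t) (e' : E' ≫ E ≅ 𝟙 s) {a : ℝ} (ha : a ≠ 0)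
    (hE : leftDim E = (a : ℂ) • 𝟙 (𝟙 s)) : IsInvertibleDual E a := by
  have ha' : (a : ℂ) ≠ 0 := by exact_mod_cast ha
  have h0 := comp_unit_eq_smul hs ht e e' ha' hE
  have hz := unit_zigzag E
  have h1 : E ◁ leftCap E ≫ (ρ_ E).hom =
      (a : ℂ) • ((α_ E (dual E) E).inv ≫ (adj E).counit ▷ E ≫ (λ_ E).hom) := by
    -- A snake is inserted so that the left cap meets a cup, where `h0` replaces the pair by `a`.
    calc _ = E ◁ leftCap E ⊗≫ (E ◁ (adj E).unit ⊗≫ (adj E).counit ▷ E) ⊗≫ 𝟙 _ := by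
          rw [hz]; bicategory
      _ = E ◁ (leftCap E ≫ (adj E).unit) ⊗≫ (adj E).counit ▷ E ⊗≫ 𝟙 _ := by bicategory
      _ = (a : ℂ) • (E ◁ (𝟙 (dual E ≫ E)) ⊗≫ (adj E).counit ▷ E ⊗≫ 𝟙 _) := by
          rw [h0]
          simp only [bicategoricalComp, whiskerLeft_smul, Linear.smul_comp]
      _ = _ := by congr 1; bicategory
  have h2 : (ρ_ E).inv ≫ E ◁ (adj E).unit =
      (a : ℂ) • ((λ_ E).inv ≫ leftCup E ▷ E ≫ (α_ E (dual E) E).hom) := by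
    have := congrArg dagger h1
    simpa only [dagger_comp, dagger_whiskerLeft, dagger_whiskerRight, dagger_smul,
      Complex.conj_ofReal, dagger_leftCap, dagger_counit, dagger_rightUnitor, dagger_leftUnitor,
      dagger_associator_inv, Category.assoc] using this
  -- After tensoring with `E`, the relation `h1` and its dagger `h2` trade both composites for cups
  -- and caps on `E* ⊗ E`, whose values are known. Two trades cost `a²` and the known value is `a`,
  -- hence `a⁻¹`.
  refine ⟨h1, whiskerRight_injective e ?_, whiskerRight_injective e ?_⟩
  · have h3 : ((a : ℂ) * (a : ℂ)) • ((adj E).counit ≫ leftCup E) ▷ E =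
        (a : ℂ) • 𝟙 ((E ≫ dual E) ≫ E) := by
      calc _ = (α_ E (dual E) E).hom ≫ ((a : ℂ) • ((α_ E (dual E) E).inv ≫
            (adj E).counit ▷ E ≫ (λ_ E).hom)) ≫ ((a : ℂ) • ((λ_ E).inv ≫ leftCup E ▷ E ≫
              (α_ E (dual E) E).hom)) ≫ (α_ E (dual E) E).inv := by
            simp only [Linear.smul_comp, Linear.comp_smul, smul_smul]
            congr 1; bicategory
        _ = (α_ E (dual E) E).hom ≫ E ◁ (leftCap E ≫ (adj E).unit) ≫ (α_ E (dual E) E).inv := by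
            rw [← h1, ← h2]; bicategory
        _ = _ := by
            rw [h0, whiskerLeft_smul, Bicategory.whiskerLeft_id, Linear.smul_comp,
              Linear.comp_smul]
            simp only [Category.id_comp, Iso.hom_inv_id]
    rw [smul_whiskerRight, Bicategory.id_whiskerRight]
    calc _ = ((a : ℂ)⁻¹ * (a : ℂ)⁻¹) • ((a : ℂ) * (a : ℂ)) •
          ((adj E).counit ≫ leftCup E) ▷ E := by
            rw [smul_smul]; field_simp; simp
      _ = _ := by rw [h3, smul_smul]; field_simp
  · have h3 : ((a : ℂ) * (a : ℂ)) • (leftCup E ≫ (adj E).counit) ▷ E =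
        (a : ℂ) • 𝟙 (𝟙 t ≫ E) := by
      calc _ = (λ_ E).hom ≫ ((a : ℂ) • ((λ_ E).inv ≫ leftCup E ▷ E ≫
              (α_ E (dual E) E).hom)) ≫ ((a : ℂ) • ((α_ E (dual E) E).inv ≫
            (adj E).counit ▷ E ≫ (λ_ E).hom)) ≫ (λ_ E).inv := by
            simp only [Linear.smul_comp, Linear.comp_smul, smul_smul]
            congr 1; bicategory
        _ = 𝟙 _ ⊗≫ E ◁ ((adj E).unit ≫ leftCap E) ⊗≫ 𝟙 _ := by
            rw [← h1, ← h2]; bicategory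
        _ = (a : ℂ) • (𝟙 (𝟙 t ≫ E) ⊗≫ E ◁ 𝟙 (𝟙 s) ⊗≫ 𝟙 (𝟙 t ≫ E)) := by
            rw [← leftDim, hE]
            simp only [bicategoricalComp, whiskerLeft_smul, Linear.smul_comp, Linear.comp_smul]
        _ = _ := by congr 1; bicategory
    rw [smul_whiskerRight, Bicategory.id_whiskerRight]
    calc _ = ((a : ℂ)⁻¹ * (a : ℂ)⁻¹) • ((a : ℂ) * (a : ℂ)) •
          (leftCup E ≫ (adj E).counit) ▷ E := by
            rw [smul_smul]; field_simp; simp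
      _ = _ := by rw [h3, smul_smul]; field_simp

end Invertible

/-! ### The two implications -/

section Equivalence

variable {B : Type u} [Bicategory.{w, v} B] [DaggerBicategory B] [PivotalBicategory B]
  [PivotalDaggerBicategory B]

/-- A unitary 2-morphism as an isomorphism. -/
def IsUnitary.iso {a b : B} {X Y : a ⟶ b} {f : X ⟶ Y} (hf : IsUnitary f) : X ≅ Y where
  hom := f
  inv := DaggerBicategory.dagger f
  hom_inv_id := hf.1
  inv_hom_id := hf.2

/-- For a unitary `τ : X ⟶ Z` and a dagger dual `L` of `Z`, the endomorphism monoid `X ⊗ X*` is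
unitarily isomorphic to `Z ⊗ L`. -/
theorem exists_unitary_to_dagger_dual {r s : B} {X Z : r ⟶ s} {L : s ⟶ r}
    {A : Bicategory.Adjunction L Z} (hA : IsDaggerDual A) {τ : X ⟶ Z} (hτ : IsUnitary τ) :
    ∃ F : X ≫ dual X ⟶ Z ≫ L, IsUnitary F ∧ leftCup X ≫ F = dagger A.counit ∧
      pairMul X ≫ F = F ▷ (X ≫ dual X) ≫ (Z ≫ L) ◁ F ≫ (α_ Z L (Z ≫ L)).hom ≫
        Z ◁ ((α_ L Z L).inv ≫ dagger A.unit ▷ L ≫ (λ_ L).hom) ∧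
      leftDim X = A.unit ≫ dagger A.unit := by
  have hψ := hA.isUnitary_mate hτ
  have h1 := unit_conjugateEquiv_symm A (adj X) (dagger τ)
  have h2 := conjugateEquiv_symm_counit A (adj X) (dagger τ)
  set ψ : dual X ⟶ L := (Bicategory.conjugateEquiv A (adj X)).symm (dagger τ) with hψd
  clear_value ψ
  have hψ1 : ψ ≫ dagger ψ = 𝟙 _ := hψ.1
  have hτ1 : τ ≫ dagger τ = 𝟙 _ := hτ.1
  have h3 : ψ ▷ X ≫ L ◁ τ ≫ dagger A.unit = leftCap X := by
    have := congrArg dagger h1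
    simp only [dagger_comp, dagger_whiskerLeft, dagger_whiskerRight, dagger_dagger,
      dagger_unit] at this
    rw [← this, ← Bicategory.comp_whiskerRight_assoc, hψ1, Bicategory.id_whiskerRight,
      Category.id_comp]
  -- The isomorphism is `τ` tensored with its mate `ψ`.
  have hF : IsUnitary (X ◁ ψ ≫ τ ▷ L) := by
    constructor
    · rw [IsIsometry, dagger_comp, dagger_whiskerLeft, dagger_whiskerRight, Category.assoc,
        ← Bicategory.comp_whiskerRight_assoc, hτ1, Bicategory.id_whiskerRight, Category.id_comp,
        ← Bicategory.whiskerLeft_comp, hψ1, Bicategory.whiskerLeft_id]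
    · rw [dagger_comp, dagger_whiskerLeft, dagger_whiskerRight, Category.assoc,
        ← Bicategory.whiskerLeft_comp_assoc, hψ.2, Bicategory.whiskerLeft_id, Category.id_comp,
        ← Bicategory.comp_whiskerRight, hτ.2, Bicategory.id_whiskerRight]
  have h4 : (X ◁ ψ ≫ τ ▷ L) ≫ A.counit = (adj X).counit := by
    rw [whisker_exchange, Category.assoc, h2, ← Bicategory.comp_whiskerRight_assoc, hτ1,
      Bicategory.id_whiskerRight, Category.id_comp]
  refine ⟨X ◁ ψ ≫ τ ▷ L, hF, ?_, ?_, ?_⟩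
  · rw [← dagger_counit, ← h4, dagger_comp, Category.assoc, hF.2, Category.comp_id]
  · unfold pairMul
    calc _ = 𝟙 _ ⊗≫ (X ◁ leftCap X ▷ dual X ⊗≫ X ◁ ψ ⊗≫ τ ▷ L) ⊗≫ 𝟙 _ := by bicategory
      _ = 𝟙 _ ⊗≫ X ◁ (ψ ▷ X ⊗≫ L ◁ τ) ▷ dual X ⊗≫
            X ◁ (dagger A.unit ▷ dual X ≫ 𝟙 _ ◁ ψ) ⊗≫ τ ▷ L ⊗≫ 𝟙 _ := by
          rw [← h3]; bicategory
      _ = 𝟙 _ ⊗≫ X ◁ (ψ ▷ X ⊗≫ L ◁ τ) ▷ dual X ⊗≫ X ◁ (L ≫ Z) ◁ ψ ⊗≫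
            (X ◁ (dagger A.unit ▷ L ≫ (λ_ L).hom) ≫ τ ▷ L) ⊗≫ 𝟙 _ := by
          rw [← whisker_exchange]; bicategory
      _ = 𝟙 _ ⊗≫ X ◁ ψ ▷ X ▷ dual X ⊗≫ (X ◁ (L ◁ (τ ▷ dual X ≫ Z ◁ ψ)) ≫
            τ ▷ (L ≫ Z ≫ L)) ⊗≫ Z ◁ (dagger A.unit ▷ L ≫ (λ_ L).hom) ⊗≫ 𝟙 _ := by
          rw [whisker_exchange]; bicategory
      _ = _ := by
          rw [whisker_exchange, ← whisker_exchange τ ψ]; bicategory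
  · calc leftDim X = ((adj X).unit ≫ ψ ▷ X) ≫ L ◁ τ ≫ dagger A.unit := by
          rw [leftDim, ← h3, Category.assoc]
      _ = _ := by
          rw [h1, Category.assoc, ← Bicategory.whiskerLeft_comp_assoc, hτ.2,
            Bicategory.whiskerLeft_id, Category.id_comp]

variable [∀ a b : B, Preadditive (a ⟶ b)] [∀ a b : B, Linear ℂ (a ⟶ b)] [LinearDaggerBicategory B]

theorem dagger_comp_counit {r s t : B} (Y : r ⟶ t) (E : t ⟶ s) :
    dagger ((adj E).comp (adj Y)).counit = leftCup Y ⊗≫ Y ◁ leftCup E ▷ dual Y ⊗≫ 𝟙 _ := by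
  rw [← isDaggerDual_comp, leftCup_comp]

theorem dagger_comp_unit {r s t : B} (Y : r ⟶ t) (E : t ⟶ s) :
    dagger ((adj E).comp (adj Y)).unit = 𝟙 _ ⊗≫ dual E ◁ leftCap Y ▷ E ⊗≫ leftCap E := by
  simp only [Bicategory.Adjunction.comp_unit, Bicategory.Adjunction.compUnit,
    bicategoricalComp, dagger_comp, dagger_whiskerLeft,
    dagger_whiskerRight, dagger_associator, dagger_id, dagger_associator_inv, dagger_leftUnitor_inv,
    Category.assoc, dagger_unit, BicategoricalCoherence.iso, Iso.trans_hom,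
    whiskerLeftIso_hom, whiskerRightIso_hom, Iso.symm_hom, Iso.refl_hom]

/-- Contract the middle factor of `Y ⊗ E ⊗ E* ⊗ Y*`. -/
def contract {r s t : B} (Y : r ⟶ t) (E : t ⟶ s) :
    (Y ≫ E) ≫ (dual E ≫ dual Y) ⟶ Y ≫ dual Y :=
  𝟙 _ ⊗≫ Y ◁ (adj E).counit ▷ dual Y ⊗≫ 𝟙 _

theorem dagger_contract {r s t : B} (Y : r ⟶ t) (E : t ⟶ s) :
    dagger (contract Y E) = 𝟙 _ ⊗≫ Y ◁ leftCup E ▷ dual Y ⊗≫ 𝟙 _ := by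
  simp only [contract, bicategoricalComp, dagger_comp, dagger_whiskerLeft,
    dagger_whiskerRight, dagger_associator, dagger_id, dagger_associator_inv, dagger_leftUnitor,
    Category.assoc, dagger_counit, BicategoricalCoherence.iso, Iso.trans_hom,
    whiskerLeftIso_hom, whiskerRightIso_hom, Iso.symm_hom, Iso.refl_hom]

theorem comp_unit_comp_dagger {r s t : B} (Y : r ⟶ t) (E : t ⟶ s) {d : ℂ}
    (hY : leftDim Y = d • 𝟙 (𝟙 t)) :
    ((adj E).comp (adj Y)).unit ≫ dagger ((adj E).comp (adj Y)).unit = d • leftDim E := by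
  rw [dagger_comp_unit, Bicategory.Adjunction.comp_unit, Bicategory.Adjunction.compUnit]
  calc _ = (adj E).unit ⊗≫ dual E ◁ ((adj Y).unit ≫ leftCap Y) ▷ E ⊗≫ leftCap E := by bicategory
    _ = d • ((adj E).unit ⊗≫ dual E ◁ (𝟙 (𝟙 t)) ▷ E ⊗≫ leftCap E) := by
        rw [← leftDim, hY]
        simp only [bicategoricalComp, whiskerLeft_smul, smul_whiskerRight, Linear.smul_comp,
          Linear.comp_smul]
    _ = _ := by unfold leftDim; congr 1; bicategory

namespace IsInvertibleDual

variable {r s t : B} {Y : r ⟶ t} {E : t ⟶ s} {a : ℝ}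

theorem contract_comp_dagger (H : IsInvertibleDual E a) :
    contract Y E ≫ dagger (contract Y E) = (a : ℂ)⁻¹ • 𝟙 _ := by
  rw [dagger_contract, contract]
  calc _ = 𝟙 ((Y ≫ E) ≫ (dual E ≫ dual Y)) ⊗≫ Y ◁ ((adj E).counit ≫ leftCup E) ▷ dual Y ⊗≫
            𝟙 ((Y ≫ E) ≫ (dual E ≫ dual Y)) := by bicategory
    _ = (a : ℂ)⁻¹ • (𝟙 ((Y ≫ E) ≫ (dual E ≫ dual Y)) ⊗≫ Y ◁ (𝟙 (E ≫ dual E)) ▷ dual Y ⊗≫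
            𝟙 ((Y ≫ E) ≫ (dual E ≫ dual Y))) := by
        rw [H.counit_leftCup]
        simp only [bicategoricalComp, whiskerLeft_smul, smul_whiskerRight, Linear.smul_comp,
          Linear.comp_smul]
    _ = _ := by congr 1; bicategory

theorem dagger_comp_contract (H : IsInvertibleDual E a) :
    dagger (contract Y E) ≫ contract Y E = (a : ℂ)⁻¹ • 𝟙 _ := by
  rw [dagger_contract, contract]
  calc _ = 𝟙 (Y ≫ dual Y) ⊗≫ Y ◁ (leftCup E ≫ (adj E).counit) ▷ dual Y ⊗≫
            𝟙 (Y ≫ dual Y) := by bicategory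
    _ = (a : ℂ)⁻¹ • (𝟙 (Y ≫ dual Y) ⊗≫ Y ◁ (𝟙 (𝟙 t)) ▷ dual Y ⊗≫ 𝟙 (Y ≫ dual Y)) := by
        rw [H.leftCup_counit]
        simp only [bicategoricalComp, whiskerLeft_smul, smul_whiskerRight, Linear.smul_comp,
          Linear.comp_smul]
    _ = _ := by congr 1; bicategory

theorem dagger_counit_contract (H : IsInvertibleDual E a) :
    dagger ((adj E).comp (adj Y)).counit ≫ contract Y E = (a : ℂ)⁻¹ • leftCup Y := by
  have h : dagger ((adj E).comp (adj Y)).counit = leftCup Y ≫ dagger (contract Y E) := by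
    rw [dagger_comp_counit, dagger_contract]; bicategory
  rw [h, Category.assoc, H.dagger_comp_contract, Linear.comp_smul, Category.comp_id]

/-- The multiplication of `(Y ⊗ E) ⊗ (E* ⊗ Y*)` caps `E* ⊗ E` in the middle. `whisker_leftCap`
replaces that cap by one on the neighbouring `E ⊗ E*`, at the cost of `a`, so both factors are
contracted separately. -/
theorem mul_contract (H : IsInvertibleDual E a) :
    ((α_ (Y ≫ E) (dual E ≫ dual Y) ((Y ≫ E) ≫ (dual E ≫ dual Y))).hom ≫
      (Y ≫ E) ◁ ((α_ (dual E ≫ dual Y) (Y ≫ E) (dual E ≫ dual Y)).inv ≫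
        dagger ((adj E).comp (adj Y)).unit ▷ (dual E ≫ dual Y) ≫ (λ_ _).hom)) ≫ contract Y E =
      (a : ℂ) • (contract Y E ▷ ((Y ≫ E) ≫ (dual E ≫ dual Y)) ≫ (Y ≫ dual Y) ◁ contract Y E ≫
        pairMul Y) := by
  have h1 := H.whisker_leftCap
  rw [dagger_comp_unit]
  unfold contract pairMul
  calc _ = 𝟙 _ ⊗≫ (Y ≫ E ≫ dual E) ◁ leftCap Y ▷ (E ≫ dual E ≫ dual Y) ⊗≫
          Y ◁ (E ◁ leftCap E ≫ (ρ_ E).hom) ▷ (dual E ≫ dual Y) ⊗≫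
            Y ◁ (adj E).counit ▷ dual Y ⊗≫ 𝟙 _ := by bicategory
    _ = (a : ℂ) • (𝟙 _ ⊗≫ (Y ≫ E ≫ dual E) ◁ leftCap Y ▷ (E ≫ dual E ≫ dual Y) ⊗≫
          Y ◁ ((α_ E (dual E) E).inv ≫ (adj E).counit ▷ E ≫ (λ_ E).hom) ▷ (dual E ≫ dual Y) ⊗≫
            Y ◁ (adj E).counit ▷ dual Y ⊗≫ 𝟙 _) := by
        rw [h1]
        simp only [bicategoricalComp, whiskerLeft_smul, smul_whiskerRight, Linear.smul_comp,
          Linear.comp_smul]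
    _ = (a : ℂ) • (𝟙 _ ⊗≫ Y ◁ ((E ≫ dual E) ◁ leftCap Y ≫ (adj E).counit ▷ 𝟙 t) ▷
          (E ≫ dual E ≫ dual Y) ⊗≫ Y ◁ (adj E).counit ▷ dual Y ⊗≫ 𝟙 _) := by
        congr 1; bicategory
    _ = (a : ℂ) • (𝟙 _ ⊗≫ Y ◁ (adj E).counit ▷ (dual Y ≫ Y ≫ E ≫ dual E ≫ dual Y) ⊗≫
          Y ◁ (leftCap Y ▷ (E ≫ dual E) ≫ 𝟙 t ◁ (adj E).counit) ▷ dual Y ⊗≫ 𝟙 _) := by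
        rw [whisker_exchange]; congr 1; bicategory
    _ = _ := by rw [← whisker_exchange]; congr 1; bicategory

end IsInvertibleDual

theorem AreEquivalent.unitarilyStarIsomorphic {r s t : B} (hs : IsSimpleObj s) (ht : IsSimpleObj t)
    {X : r ⟶ s} {Y : r ⟶ t} {dX dY : ℝ} (hdX : 0 < dX) (hdY : 0 < dY)
    (hX : leftDim X = (dX : ℂ) • 𝟙 (𝟙 s)) (hY : leftDim Y = (dY : ℂ) • 𝟙 (𝟙 t))
    (h : AreEquivalent X Y) :
    UnitarilyStarIsomorphic (pairFrobenius X dX hdX) (pairFrobenius Y dY hdY) := by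
  obtain ⟨E, ⟨E', η, e, hη, he⟩, τ, hτ⟩ := h
  obtain ⟨F, hF, hF1, hFm, hdim⟩ := exists_unitary_to_dagger_dual (isDaggerDual_comp Y E) hτ
  obtain ⟨a, ha⟩ := hs.hasScalarEnd (leftDim E)
  have hY0 : (dY : ℂ) ≠ 0 := by exact_mod_cast hdY.ne'
  have hX0 : (dX : ℂ) ≠ 0 := by exact_mod_cast hdX.ne'
  -- Left dimension is multiplicative along `X ≅ Y ⊗ E`, so `dX = dY a`.
  have ha0 : a = ((dX / dY : ℝ) : ℂ) := by
    rw [comp_unit_comp_dagger Y E hY, ha, smul_smul, hX] at hdim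
    have h1 : ((dX : ℂ) - dY * a) • 𝟙 (𝟙 s) = 0 := by rw [sub_smul, hdim, sub_self]
    have h2 := (smul_eq_zero.1 h1).resolve_right hs.id_ne_zero
    push_cast
    field_simp
    linear_combination -h2
  subst ha0
  have H := isInvertibleDual hs ht he.iso hη.iso.symm (div_pos hdX hdY).ne' ha
  set a : ℝ := dX / dY with hadef
  have hapos : 0 < a := div_pos hdX hdY
  have hac : (a : ℂ) ≠ 0 := by exact_mod_cast hapos.ne'
  -- `contract` followed by its dagger is `a⁻¹`, so the factor `√a` makes it unitary. It also equals
  -- `√dX / √dY`, as the normalisations of product and unit require.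
  set k : ℝ := Real.sqrt a with hk
  have hkk : (k : ℂ) * (k : ℂ) = a := by
    rw [← Complex.ofReal_mul, Real.mul_self_sqrt hapos.le]
  have hk0 : (k : ℂ) ≠ 0 := by exact_mod_cast (Real.sqrt_pos.2 hapos).ne'
  have hsq : (Real.sqrt dX : ℂ) = k * (Real.sqrt dY : ℂ) := by
    rw [hk, hadef, ← Complex.ofReal_mul, ← Real.sqrt_mul hapos.le, div_mul_cancel₀ _ hdY.ne']
  have hsY : (Real.sqrt dY : ℂ) ≠ 0 := by exact_mod_cast (Real.sqrt_pos.2 hdY).ne'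
  have hu : IsUnitary ((k : ℂ) • (F ≫ contract Y E)) := by
    constructor
    · rw [IsIsometry, dagger_smul, Complex.conj_ofReal, Linear.smul_comp, Linear.comp_smul,
        smul_smul, hkk, dagger_comp, Category.assoc, ← Category.assoc (contract Y E),
        H.contract_comp_dagger, Linear.smul_comp, Linear.comp_smul, Category.id_comp, hF.1,
        smul_smul, mul_inv_cancel₀ hac, one_smul]
    · rw [dagger_smul, Complex.conj_ofReal, Linear.smul_comp, Linear.comp_smul,
        smul_smul, hkk, dagger_comp, Category.assoc, ← Category.assoc _ F, hF.2,
        Category.id_comp, H.dagger_comp_contract, smul_smul, mul_inv_cancel₀ hac, one_smul]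
  refine ⟨(k : ℂ) • (F ≫ contract Y E), hu, isStarHom_of_isUnitary hu ?_ ?_⟩
  · change ((((Real.sqrt dX)⁻¹ : ℝ) : ℂ) • pairMul X) ≫ ((k : ℂ) • (F ≫ contract Y E)) =
      ((k : ℂ) • (F ≫ contract Y E)) ▷ (X ≫ dual X) ≫ (Y ≫ dual Y) ◁
        ((k : ℂ) • (F ≫ contract Y E)) ≫ ((((Real.sqrt dY)⁻¹ : ℝ) : ℂ) • pairMul Y)
    have h1 : pairMul X ≫ F ≫ contract Y E = (a : ℂ) • ((F ≫ contract Y E) ▷ (X ≫ dual X) ≫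
        (Y ≫ dual Y) ◁ (F ≫ contract Y E) ≫ pairMul Y) := by
      rw [← Category.assoc, hFm]
      simp only [Category.assoc]
      have h2 := H.mul_contract (Y := Y)
      simp only [Category.assoc] at h2
      rw [h2, Linear.comp_smul, Linear.comp_smul, whisker_exchange_assoc]
      simp only [Category.assoc, Bicategory.comp_whiskerRight, Bicategory.whiskerLeft_comp]
    simp only [smul_whiskerRight, whiskerLeft_smul, Linear.smul_comp, Linear.comp_smul, smul_smul,
      h1]
    congr 1
    push_cast
    rw [hsq, ← hkk]
    field_simp
  · change (((Real.sqrt dX : ℝ) : ℂ) • leftCup X) ≫ ((k : ℂ) • (F ≫ contract Y E)) =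
      ((Real.sqrt dY : ℝ) : ℂ) • leftCup Y
    rw [Linear.smul_comp, Linear.comp_smul, ← Category.assoc, hF1, H.dagger_counit_contract,
      smul_smul, smul_smul]
    congr 1
    rw [hsq, ← hkk]
    field_simp

theorem UnitarilyStarIsomorphic.areEquivalent (hsplit : HasSplitDaggerIdempotents B) {r s t : B}
    {X : r ⟶ s} {Y : r ⟶ t} {dX dY : ℝ} (hdX : 0 < dX) (hdY : 0 < dY)
    (hX : leftDim X = (dX : ℂ) • 𝟙 (𝟙 s)) (hY : leftDim Y = (dY : ℂ) • 𝟙 (𝟙 t))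
    (h : UnitarilyStarIsomorphic (pairFrobenius X dX hdX) (pairFrobenius Y dY hdY)) :
    AreEquivalent X Y := by
  obtain ⟨f, hf, hm⟩ := h
  have hf1 : f ≫ dagger f = 𝟙 _ := hf.1
  have hsX : (Real.sqrt dX : ℂ) ≠ 0 := by exact_mod_cast (Real.sqrt_pos.2 hdX).ne'
  have hsY : (Real.sqrt dY : ℂ) ≠ 0 := by exact_mod_cast (Real.sqrt_pos.2 hdY).ne'
  have hXX : (Real.sqrt dX : ℂ) * (Real.sqrt dX : ℂ) = dX := by
    rw [← Complex.ofReal_mul, Real.mul_self_sqrt hdX.le]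
  have hYY : (Real.sqrt dY : ℂ) * (Real.sqrt dY : ℂ) = dY := by
    rw [← Complex.ofReal_mul, Real.mul_self_sqrt hdY.le]
  have h1 := hm.map_one
  have h2 := hm.map_mul
  change X ≫ dual X ⟶ Y ≫ dual Y at f
  change (((Real.sqrt dX : ℝ) : ℂ) • leftCup X) ≫ f = ((Real.sqrt dY : ℝ) : ℂ) • leftCup Y at h1
  change ((((Real.sqrt dX)⁻¹ : ℝ) : ℂ) • pairMul X) ≫ f = f ▷ (X ≫ dual X) ≫ (Y ≫ dual Y) ◁ f ≫
    ((((Real.sqrt dY)⁻¹ : ℝ) : ℂ) • pairMul Y) at h2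
  -- The factor `√dX / √dY` removes the normalisations from the unit and multiplication. Since `f`
  -- is unitary, the dagger of the rescaled map is `dX / dY` times its inverse.
  have key : IsPairIso X Y (dX / dY) (((Real.sqrt dX / Real.sqrt dY : ℝ) : ℂ) • f)
      (((Real.sqrt dY / Real.sqrt dX : ℝ) : ℂ) • dagger f) := by
    refine ⟨(div_pos hdX hdY).ne', ?_, ?_, ?_, ?_, ?_⟩
    · rw [Linear.smul_comp, Linear.comp_smul, smul_smul]
      have : ((Real.sqrt dX / Real.sqrt dY : ℝ) : ℂ) * ((Real.sqrt dY / Real.sqrt dX : ℝ) : ℂ) = 1 := by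
        push_cast; field_simp
      rw [this, one_smul]; exact hf1
    · rw [Linear.smul_comp, Linear.comp_smul, smul_smul]
      have : ((Real.sqrt dY / Real.sqrt dX : ℝ) : ℂ) * ((Real.sqrt dX / Real.sqrt dY : ℝ) : ℂ) = 1 := by
        push_cast; field_simp
      rw [this, one_smul]; exact hf.2
    · rw [dagger_smul, Complex.conj_ofReal, smul_smul]
      congr 1
      push_cast
      rw [← hXX, ← hYY]
      field_simp
    · rw [Linear.smul_comp, Linear.comp_smul] at h2
      rw [Linear.comp_smul] at h2
      simp only [smul_whiskerRight, whiskerLeft_smul, Linear.smul_comp, Linear.comp_smul, smul_smul]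
      have h3 : pairMul X ≫ f = ((Real.sqrt dX : ℂ) * (Real.sqrt dY : ℂ)⁻¹) •
          (f ▷ (X ≫ dual X) ≫ (Y ≫ dual Y) ◁ f ≫ pairMul Y) := by
        rw [mul_smul, ← Complex.ofReal_inv, ← h2, smul_smul]
        push_cast
        rw [mul_inv_cancel₀ hsX, one_smul]
      rw [h3, smul_smul]
      congr 1
      push_cast
      field_simp
    · rw [Linear.smul_comp] at h1
      rw [Linear.comp_smul]
      push_cast
      rw [div_eq_inv_mul, mul_smul, h1, smul_smul, inv_mul_cancel₀ hsY, one_smul]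
  exact key.areEquivalent hsplit hdX hdY hX hY

end Equivalence

end PivotalDagger

theorem mainTheorem6 {B : Type u} [Bicategory.{w, v} B]
    [DaggerBicategory B] [PivotalBicategory B] [PivotalDaggerBicategory B]
    [∀ a b : B, Preadditive (a ⟶ b)] [∀ a b : B, Linear ℂ (a ⟶ b)] [LinearDaggerBicategory B]
    (hsplit : HasSplitDaggerIdempotents B)
    {r s t : B} (hs : IsSimpleObj s) (ht : IsSimpleObj t) (X : r ⟶ s) (Y : r ⟶ t)
    (dX dY : ℝ) (hdX : 0 < dX) (hdY : 0 < dY)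
    (hX : leftDim X = (dX : ℂ) • 𝟙 (𝟙 s)) (hY : leftDim Y = (dY : ℂ) • 𝟙 (𝟙 t)) :
    AreEquivalent X Y ↔
      UnitarilyStarIsomorphic (pairFrobenius X dX hdX) (pairFrobenius Y dY hdY) :=
  ⟨fun h => h.unitarilyStarIsomorphic hs ht hdX hdY hX hY,
    fun h => h.areEquivalent hsplit hdX hdY hX hY⟩
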